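/- **Conventions.** A *sequence* is a nonempty finite sequence $\alpha=(\alpha_1,\dots,\alpha_k)$ of positive integers, or the degenerate sequence $(0)$. Its length is $k$ and its degree is $D(\alpha)=\sum_i\alpha_i$. For distinct sequences, put $\alpha<\beta$ if the first nonzero term of $(\alpha_1,-\alpha_2,\alpha_3,\dots,0,0,\dots)-(\beta_1,-\beta_2,\beta_3,\dots,0,0,\dots)$ is negative. The sequence $\alpha$ is *lexical* if $\alpha>(\alpha_i,\dots,\alpha_k)$ for $2\le i\le k$, and $L_n$ is the set of lexical sequences with $1+D(\alpha)=n$ (so $L_1=\{(0)\}$). We write $\alpha\lessdot\beta$ in $L_n$ if $\alpha,\beta\in L_n$, $\alpha<\beta$, and no $\gamma\in L_n$ satisfies $\alpha<\gamma<\beta$. Juxtaposition is concatenation and $1^q$ is $1$ repeated $q$ times. Let $\alpha_e$ (resp. $\alpha_o$) be the sequence of even (resp. odd) length among $(\alpha_1,\dots,\alpha_k+1)$ and $(\alpha_1,\dots,\alpha_k,1)$. The harmonics of $(0)$ are $h_0(0)=(0)$, $h_1(0)=(1)$, $h_j(0)=(h_{j-1}(0))_o\,h_{j-1}(0)$ for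 $j\ge2$. The star product is $$\alpha\star\beta=\alpha_o(\alpha_e)^{\beta_1-1}\alpha_o(\alpha_e)^{\beta_2-1}\cdots\alpha_o(\alpha_e)^{\beta_k-1}\alpha ,\qquad (0)\star\beta=\beta .$$ For distinct $\alpha,\beta$ that first differ at a place $i$ where both have an entry, $\alpha\wedge\beta=(\alpha_1,\dots,\alpha_{i-1},\min(\alpha_i,\beta_i))$. For even $i\le k$, the *elementary operation* on the $i$-th cell of $\alpha$ gives $(\alpha_1,\dots,\alpha_i-1,1,\alpha_{i+1},\dots,\alpha_k)$ if $\alpha_i>1$, and $(\alpha_1,\dots,\alpha_{i-1}+1,\alpha_{i+1},\dots,\alpha_k)$ if $\alpha_i=1$. For $n=2^l(2s+1)\ge1$ put $\mu_n=h_l(0)$ if $s=0$ and $\mu_n=h_l(0)\star(2,1^{2s-2})$ if $s>0$. **Algorithm.** Start with $\alpha=\mu_n$. While $\alpha\ne(n-1)$: apply the elementary operation to the $i$-th cell of $\alpha$, where $i$ is the largest even index for which the result $\alpha'$ is a successor of $\alpha$ ($\alpha<\alpha'$) in $L_n$; put $f=\alpha\wedge\alpha'$ and $m=D(f)+1$;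 if $m\mid n$, replace $\alpha'$ by $f\star\lambda$ with $\lambda=\mu_{n/m}$; continue with $\alpha'$ in place of $\alpha$. **Theorem.** Let $n\ge1$. 1. $\mu_n$ is the least and $(n-1)$ the greatest element of $L_n$. 2. For every $\alpha\in L_n$ with $\alpha\neq(n-1)$, the required index $i$ exists, and with $\alpha',f,m$ as above (before the replacement) $f\in L_m$. If $m\nmid n$, then $\alpha\lessdot\alpha'$ in $L_n$. If $m\mid n$, then $\lambda=\mu_{n/m}$ is the least element of $L_{n/m}$ and $\alpha\lessdot f\star\lambda$ in $L_n$. 3. The algorithm started at $\mu_n$ terminates at $(n-1)$, and the sequences it goes through are exactly the elements of $L_n$, listed in strictly increasing order. -/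

import Mathlib

namespace LexSeq

/-- `a` is an admissible sequence: a nonempty finite sequence of positive integers, or the
degenerate sequence `(0)`. -/
def IsSeq (a : List ℕ) : Prop :=
  a = [0] ∨ (a ≠ [] ∧ ∀ x ∈ a, 0 < x)

/-- The degree (sum of all entries). -/
def degree (a : List ℕ) : ℕ := a.sum

/-- The alternating sequence `(a₁, -a₂, a₃, …, ± a_k, 0, 0, …)`, indexed from `0`. -/
def al (a : List ℕ) (i : ℕ) : ℤ := (-1) ^ i * (a.getD i 0 : ℤ)

/-- The lexical order: `a < b` iff the first nonzero term of `al a - al b` is negative. -/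
def SeqLT (a b : List ℕ) : Prop :=
  ∃ i, (∀ j < i, al a j = al b j) ∧ al a i < al b i

/-- The witness in the definition of the order may be searched below the two lengths. -/
theorem seqLT_iff (a b : List ℕ) :
    SeqLT a b ↔
      ∃ i < a.length + b.length, (∀ j < i, al a j = al b j) ∧ al a i < al b i := by
  constructor
  · rintro ⟨i, h1, h2⟩
    refine ⟨i, ?_, h1, h2⟩
    by_contra hi
    have ha : al a i = 0 := by
      unfold al
      rw [List.getD_eq_default _ _ (by omega)]
      simp
    have hb : al b i = 0 := by
      unfold al
      rw [List.getD_eq_default _ _ (by omega)]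
      simp
    omega
  · rintro ⟨i, -, h⟩
    exact ⟨i, h⟩

instance (a b : List ℕ) : Decidable (SeqLT a b) :=
  decidable_of_iff _ (seqLT_iff a b).symm

/-- `a` is lexical: it is greater than each of its proper right sequences. -/
def IsLexical (a : List ℕ) : Prop :=
  ∀ i < a.length, 0 < i → SeqLT (a.drop i) a

/-- `L n`: the lexical sequences `a` with `1 + degree a = n`; thus `L 1 = {(0)}`. -/
def L (n : ℕ) : Set (List ℕ) :=
  {a | IsSeq a ∧ IsLexical a ∧ 1 + degree a = n}

instance (n : ℕ) (a : List ℕ) : Decidable (a ∈ L n) :=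
  inferInstanceAs (Decidable ((a = [0] ∨ (a ≠ [] ∧ ∀ x ∈ a, 0 < x)) ∧
    (∀ i < a.length, 0 < i → SeqLT (a.drop i) a) ∧ 1 + degree a = n))

/-- `a` is adjacent to `b` in `S`: `b` is the immediate successor of `a` in `S`. -/
def AdjIn (S : Set (List ℕ)) (a b : List ℕ) : Prop :=
  a ∈ S ∧ b ∈ S ∧ SeqLT a b ∧ ¬ ∃ c ∈ S, SeqLT a c ∧ SeqLT c b

/-- `m` is the least element of `S`. -/
def IsLeastIn (S : Set (List ℕ)) (m : List ℕ) : Prop :=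
  m ∈ S ∧ ∀ a ∈ S, a ≠ m → SeqLT m a

/-- `m` is the greatest element of `S`. -/
def IsGreatestIn (S : Set (List ℕ)) (m : List ℕ) : Prop :=
  m ∈ S ∧ ∀ a ∈ S, a ≠ m → SeqLT a m

/-- Increase the last entry by one. -/
def incLast : List ℕ → List ℕ
  | [] => []
  | [x] => [x + 1]
  | x :: y :: l => x :: incLast (y :: l)

/-- `a_e`, of even length. -/
def evenExt (a : List ℕ) : List ℕ :=
  if Even a.length then incLast a else a ++ [1]

/-- `a_o`, of odd length. -/
def oddExt (a : List ℕ) : List ℕ :=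
  if Even a.length then a ++ [1] else incLast a

/-- The harmonics `h_0(a) = a`, `h_{j+1}(a) = (h_j(a))_o h_j(a)`. The degenerate sequence `(0)` is
the empty word as a right factor, so that `h_1((0)) = (1)`. -/
def harmonic : ℕ → List ℕ → List ℕ
  | 0, a => a
  | j + 1, a =>
    if harmonic j a = [0] then [1] else oddExt (harmonic j a) ++ harmonic j a

/-- The star product `a_o (a_e)^(b₁ - 1) a_o (a_e)^(b₂ - 1) ⋯ a_o (a_e)^(b_k - 1) a`;
the degenerate sequence `(0)` is a left identity. -/
def starProd (a b : List ℕ) : List ℕ :=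
  if a = [0] then b
  else (b.flatMap fun x => oddExt a ++ (List.replicate (x - 1) (evenExt a)).flatten) ++ a

/-- `a ∧ b`: the common initial entries followed by the smaller of the first two entries that
differ (and by nothing if one of the sequences is an initial part of the other). -/
def wedge : List ℕ → List ℕ → List ℕ
  | x :: a, y :: b => if x = y then x :: wedge a b else [min x y]
  | _, _ => []

/-- The elementary operation on the `i`-th cell (`1 ≤ i ≤ length`) of `a`: splitting if the value
of the cell is greater than `1`, conjugation with the cell on its left if the value is `1`.
The value is `none` where neither is defined. -/
def elemOp (a : List ℕ) (i : ℕ) : Option (List ℕ) :=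
  if i = 0 ∨ a.length < i then none
  else
    let v := a.getD (i - 1) 0
    if 1 < v then
      let left := a.take (i - 1) ++ [v - 1]
      some ((if Even i then oddExt left else evenExt left) ++ a.drop i)
    else if v = 1 ∧ 1 < i then
      let left := a.take (i - 1)
      some ((if Even i then oddExt left else evenExt left) ++ a.drop i)
    else none

/-- The result of the elementary operation on cell `i` of `a`, provided that `i` is even and that
this result is a successor of `a` in `L n`. -/
def raiseAt (n : ℕ) (a : List ℕ) (i : ℕ) : Option (List ℕ) :=
  if Even i then (elemOp a i).filter fun b => decide (b ∈ L n ∧ SeqLT a b) else none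

/-- The elementary operation applied to the tail of the longest left sequence of `a`, of even
length, which gives a lexical successor in `L n`: the lengths are tried in the order
`length a, …, 2, 1, 0`. -/
def raise (n : ℕ) (a : List ℕ) : Option (List ℕ) :=
  (List.range (a.length + 1)).reverse.findSome? (raiseAt n a)

/-- The sequence `h_l(0)` if `s = 0`, and `h_l(0) ⋆ (2, 1^(2s-2))` if `s > 0`. -/
def startSeq (l s : ℕ) : List ℕ :=
  if s = 0 then harmonic l [0]
  else starProd (harmonic l [0]) (2 :: List.replicate (2 * s - 2) 1)

/-- `startSeq l s` for the `l` and `s` with `n = 2^l (2s+1)`, where `n > 0`. -/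
def start (n : ℕ) : List ℕ :=
  startSeq (padicValNat 2 n) (n / 2 ^ padicValNat 2 n / 2)

/-- One round of the algorithm: from `a` compute `a'` by the elementary operation,
`f = a ∧ a'` and `m = degree f + 1`; return `f ⋆ λ` if `m ∣ n`, where `λ` is the starting sequence
computed for `d = n / m`, and `a'` otherwise. -/
def step (n : ℕ) (a : List ℕ) : Option (List ℕ) :=
  (raise n a).map fun a' =>
    let f := wedge a a'
    let m := degree f + 1
    if m ∣ n then starProd f (start (n / m)) else a'

/-- `Run n a out`: the iteration of `step n` beginning with `a` terminates at `(n - 1)`, and `out`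
is the list of all sequences it goes through. -/
inductive Run (n : ℕ) : List ℕ → List (List ℕ) → Prop
  | halt : Run n [n - 1] [[n - 1]]
  | next {a b : List ℕ} {out : List (List ℕ)} :
      a ≠ [n - 1] → step n a = some b → Run n b out → Run n a (a :: out)

end LexSeq

open LexSeq

namespace LexSeq

/-! ### Integer sequences in lexicographic order, and words acting on them -/

/-! Encode a sequence α by the word 1^{α₁}0^{α₂}1^{α₃}⋯, with letter values 1 and -1 and zeros
appended. The order of sequences becomes the lexicographic order (`seqLT_iff_emb`), negation becomes
complementation (written w̄), and α is lexical iff its word exceeds all its proper suffixes and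
their complements (`IsSeq.isLexical_iff`). The elementary operation on an even cell turns the last 0
of that run into 1 and complements what follows (`elemOp_spec`); the star product becomes the
substitution `phi` (`starProd_spec`).

Let α = p0t and β = p1b̄ be consecutive lexical words of length n - 1, p being their common prefix,
and let ω = p0p0p0⋯ (`om p`). The suffixes of α and their complements lie below ω (`Lexi.adm`). The
greatest word p0M of this length with that weaker property is already lexical (`IsMaxAdm.lexi`), so
t = M, since nothing lies between α and β.

If b < ω, then b ≤ M (`IsMaxAdm.le_of_lexi`) and p1M̄ is lexical as well (`Lexi.true_bar_of_le`); as
p1M̄ ≤ p1b̄, the successor is p1t̄, the result of the elementary operation. If b > ω, then β is a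
substitution `phi p true δ` (`Lexi.exists_phi`), so m = |p| + 1 divides n. Conversely, if m ∣ n,
substituting into the least word of length n/m - 1 gives a lexical word beginning with p1.
Minimality of β then forces b > ω, and since `phi` preserves the order and both preserves and
reflects lexicality, β is that word. In this case p1t̄ is still lexical (`IsMaxAdm.lexi_true_bar`),
so the algorithm can find p.

It does find p: t is empty or begins with 1, so the 0 after p ends its run, and raising a later cell
would give a lexical p0X with X > M (`raise_eq`).

For the least words the same dichotomy is used with p = 1: a lexical word of length at least 2 has
the form 11b̄. Odd n > 1 gives the alternating tail, even n the substitution of 1 into the least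
word for n/2. -/

/-- Integer sequences, ordered lexicographically. -/
def ZSeq := Lex (ℕ → ℤ)

noncomputable instance : LinearOrder ZSeq := inferInstanceAs (LinearOrder (Lex (ℕ → ℤ)))

instance : AddCommGroup ZSeq := inferInstanceAs (AddCommGroup (ℕ → ℤ))

/-- The entries of a sequence. -/
def ZSeq.get (x : ZSeq) (n : ℕ) : ℤ := (ofLex x : ℕ → ℤ) n

/-- The sequence with given entries. -/
def ZSeq.mk (f : ℕ → ℤ) : ZSeq := toLex f

@[simp] theorem ZSeq.get_mk (f : ℕ → ℤ) (n : ℕ) : (ZSeq.mk f).get n = f n := rfl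
@[simp] theorem ZSeq.get_zero (n : ℕ) : (0 : ZSeq).get n = 0 := rfl
@[simp] theorem ZSeq.get_neg (x : ZSeq) (n : ℕ) : (-x).get n = -x.get n := rfl

/-- The value `1` or `-1` of a letter. -/
def sgn (b : Bool) : ℤ := if b then 1 else -1

/-- Prepend a letter to a sequence. -/
def cons (b : Bool) (x : ZSeq) : ZSeq :=
  ZSeq.mk fun n => Nat.casesOn n (sgn b) x.get

/-- Prepend a word to a sequence. -/
def app (w : List Bool) (x : ZSeq) : ZSeq := w.foldr cons x

/-- A word followed by zeros. -/
def emb (w : List Bool) : ZSeq := app w 0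

/-- The complementary word. -/
def bar (w : List Bool) : List Bool := w.map (!·)

@[simp] theorem bar_nil : bar [] = [] := rfl
@[simp] theorem bar_cons (b : Bool) (w : List Bool) : bar (b :: w) = (!b) :: bar w := rfl
@[simp] theorem bar_append (u v : List Bool) : bar (u ++ v) = bar u ++ bar v := by simp [bar]
@[simp] theorem bar_bar (w : List Bool) : bar (bar w) = w := by
  induction w <;> simp_all
@[simp] theorem length_bar (w : List Bool) : (bar w).length = w.length := by simp [bar]

theorem bar_eq_iff {u v : List Bool} : bar u = v ↔ u = bar v :=
  ⟨fun h => by rw [← h, bar_bar], fun h => by rw [h, bar_bar]⟩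

theorem bar_suffix {u v : List Bool} (h : u <:+ v) : bar u <:+ bar v := by
  obtain ⟨t, rfl⟩ := h
  exact ⟨bar t, by simp⟩

@[simp] theorem app_nil (x : ZSeq) : app [] x = x := rfl
@[simp] theorem app_cons (b : Bool) (w : List Bool) (x : ZSeq) :
    app (b :: w) x = cons b (app w x) := rfl
@[simp] theorem app_append (u v : List Bool) (x : ZSeq) : app (u ++ v) x = app u (app v x) := by
  induction u <;> simp_all
@[simp] theorem app_emb (u v : List Bool) : app u (emb v) = emb (u ++ v) := by simp [emb]
theorem emb_append (u v : List Bool) : emb (u ++ v) = app u (emb v) := by simp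
theorem emb_cons (b : Bool) (v : List Bool) : emb (b :: v) = cons b (emb v) := rfl
@[simp] theorem cons_emb (b : Bool) (v : List Bool) : cons b (emb v) = emb (b :: v) := rfl
theorem emb_nil : emb [] = 0 := rfl

theorem cons_zero (b : Bool) (x : ZSeq) : (cons b x).get 0 = sgn b := rfl
theorem cons_succ (b : Bool) (x : ZSeq) (n : ℕ) : (cons b x).get (n + 1) = x.get n := rfl

theorem ZSeq.lt_iff {x y : ZSeq} :
    x < y ↔ ∃ i, (∀ j < i, x.get j = y.get j) ∧ x.get i < y.get i := Iff.rfl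

theorem ZSeq.ext {x y : ZSeq} (h : ∀ n, x.get n = y.get n) : x = y := funext h

theorem ZSeq.lt_of_head {x y : ZSeq} (h : x.get 0 < y.get 0) : x < y :=
  ⟨0, by simp, h⟩

theorem ZSeq.exists_cons {x : ZSeq} {b : Bool} (h : x.get 0 = sgn b) : ∃ y, x = cons b y :=
  ⟨ZSeq.mk fun n => x.get (n + 1), ZSeq.ext fun n => by cases n <;> first | exact h | rfl⟩

@[simp] theorem cons_lt_cons {b : Bool} {x y : ZSeq} : cons b x < cons b y ↔ x < y := by
  rw [ZSeq.lt_iff, ZSeq.lt_iff]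
  constructor
  · rintro ⟨i, h1, h2⟩
    cases i with
    | zero => simp [cons_zero] at h2
    | succ i => exact ⟨i, fun j hj => h1 (j + 1) (by omega), h2⟩
  · rintro ⟨i, h1, h2⟩
    refine ⟨i + 1, fun j hj => ?_, h2⟩
    cases j with
    | zero => rfl
    | succ j => exact h1 j (by omega)

@[simp] theorem cons_inj {b : Bool} {x y : ZSeq} : cons b x = cons b y ↔ x = y :=
  ⟨fun h => ZSeq.ext fun n => by rw [← cons_succ b x, h, cons_succ], fun h => by rw [h]⟩

@[simp] theorem cons_le_cons {b : Bool} {x y : ZSeq} : cons b x ≤ cons b y ↔ x ≤ y := by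
  rw [← not_lt, ← not_lt, cons_lt_cons]

@[simp] theorem cons_false_lt (x y : ZSeq) : cons false x < cons true y :=
  ZSeq.lt_of_head (by simp [cons_zero, sgn])

@[simp] theorem not_cons_true_lt (x y : ZSeq) : ¬ cons true x < cons false y :=
  (cons_false_lt y x).asymm

@[simp] theorem cons_false_lt_zero (x : ZSeq) : cons false x < 0 :=
  ZSeq.lt_of_head (by simp [cons_zero, sgn])

@[simp] theorem zero_lt_cons_true (x : ZSeq) : 0 < cons true x :=
  ZSeq.lt_of_head (by simp [cons_zero, sgn])

theorem cons_ne_zero (b : Bool) (x : ZSeq) : cons b x ≠ 0 := by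
  cases b
  · exact (cons_false_lt_zero x).ne
  · exact (zero_lt_cons_true x).ne'

@[simp] theorem cons_true_ne (x y : ZSeq) : cons true x ≠ cons false y :=
  (cons_false_lt y x).ne'

@[simp] theorem app_lt_app {w : List Bool} {x y : ZSeq} : app w x < app w y ↔ x < y := by
  induction w <;> simp_all

@[simp] theorem app_le_app {w : List Bool} {x y : ZSeq} : app w x ≤ app w y ↔ x ≤ y := by
  rw [← not_lt, ← not_lt, app_lt_app]

@[simp] theorem app_inj {w : List Bool} {x y : ZSeq} : app w x = app w y ↔ x = y := by
  induction w <;> simp_all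

theorem cons_eq_cons {a b : Bool} {x y : ZSeq} : cons a x = cons b y ↔ a = b ∧ x = y := by
  cases a <;> cases b <;> simp [(cons_true_ne _ _).symm]

theorem neg_lt_neg_seq {x y : ZSeq} : -x < -y ↔ y < x := by
  have key : ∀ {x y : ZSeq}, y < x → -x < -y := by
    rintro x y ⟨i, h1, h2⟩
    refine ⟨i, fun j hj => ?_, ?_⟩
    · exact congrArg Neg.neg (h1 j hj).symm
    · exact Int.neg_lt_neg h2
  exact ⟨fun h => by simpa using key h, key⟩

theorem neg_le_neg_seq {x y : ZSeq} : -x ≤ -y ↔ y ≤ x := by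
  rw [← not_lt, ← not_lt, neg_lt_neg_seq]

theorem neg_lt_seq {x y : ZSeq} : -x < y ↔ -y < x := by
  rw [← neg_lt_neg_seq, neg_neg]

theorem lt_neg_seq {x y : ZSeq} : x < -y ↔ y < -x := by
  rw [← neg_lt_neg_seq, neg_neg]

@[simp] theorem neg_cons (b : Bool) (x : ZSeq) : -(cons b x) = cons (!b) (-x) :=
  ZSeq.ext fun n => by
    cases n with
    | zero => cases b <;> rfl
    | succ n => rfl

@[simp] theorem neg_app (w : List Bool) (x : ZSeq) : -(app w x) = app (bar w) (-x) := by
  induction w <;> simp_all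

@[simp] theorem neg_emb (w : List Bool) : -(emb w) = emb (bar w) := by simp [emb]

theorem emb_bar (w : List Bool) : emb (bar w) = -(emb w) := by simp

/-- A word compared with a sequence: either the first difference decides, or the word is an
initial part of the sequence. -/
theorem app_trichotomy (e : List Bool) (y : ZSeq) :
    (∀ x, app e x < y) ∨ (∃ y', y = app e y') ∨ ∀ x, y < app e x := by
  induction e generalizing y with
  | nil => exact Or.inr (Or.inl ⟨y, rfl⟩)
  | cons b e ih =>
    rcases lt_trichotomy (sgn b) (y.get 0) with h | h | h
    · exact Or.inl fun x => ZSeq.lt_of_head h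
    · obtain ⟨y, rfl⟩ := ZSeq.exists_cons h.symm
      rcases ih y with h | ⟨y', rfl⟩ | h
      · exact Or.inl fun x => by simpa using h x
      · exact Or.inr (Or.inl ⟨y', rfl⟩)
      · exact Or.inr (Or.inr fun x => by simpa using h x)
    · exact Or.inr (Or.inr fun x => ZSeq.lt_of_head h)

theorem exists_app_of_le_of_lt {w : List Bool} {x x' y : ZSeq} (h1 : app w x ≤ y)
    (h2 : y < app w x') : ∃ y', y = app w y' := by
  rcases app_trichotomy w y with h | h | h
  · exact absurd (h x') h2.asymm
  · exact h
  · exact absurd (h x) h1.not_gt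

theorem exists_app_of_le_of_le {w : List Bool} {x x' y : ZSeq} (h1 : app w x ≤ y)
    (h2 : y ≤ app w x') : ∃ y', y = app w y' := by
  rcases h2.eq_or_lt with h | h
  · exact ⟨x', h⟩
  · exact exists_app_of_le_of_lt h1 h

theorem emb_eq_app {c w : List Bool} {y : ZSeq} (h : emb c = app w y) :
    ∃ v, c = w ++ v ∧ y = emb v := by
  induction w generalizing c with
  | nil => exact ⟨c, rfl, h.symm⟩
  | cons b w ih =>
    cases c with
    | nil => exact absurd h.symm (cons_ne_zero _ _)
    | cons a c =>
      rw [emb_cons, app_cons, cons_eq_cons] at h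
      obtain ⟨v, rfl, hv⟩ := ih h.2
      exact ⟨v, by simp [h.1], hv⟩

theorem emb_inj {u v : List Bool} : emb u = emb v ↔ u = v := by
  refine ⟨fun h => ?_, fun h => by rw [h]⟩
  obtain ⟨w, rfl, hw⟩ := emb_eq_app (w := v) (y := 0) h
  cases w with
  | nil => simp
  | cons b w => exact absurd hw.symm (cons_ne_zero _ _)

@[simp] theorem emb_append_lt {w u v : List Bool} :
    emb (w ++ u) < emb (w ++ v) ↔ emb u < emb v := by
  rw [emb_append, emb_append, app_lt_app]

@[simp] theorem emb_append_le {w u v : List Bool} :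
    emb (w ++ u) ≤ emb (w ++ v) ↔ emb u ≤ emb v := by
  rw [emb_append, emb_append, app_le_app]

@[simp] theorem emb_cons_lt {b : Bool} {u v : List Bool} :
    emb (b :: u) < emb (b :: v) ↔ emb u < emb v := cons_lt_cons

@[simp] theorem emb_cons_le {b : Bool} {u v : List Bool} :
    emb (b :: u) ≤ emb (b :: v) ↔ emb u ≤ emb v := cons_le_cons

@[simp] theorem emb_false_lt_true (u v : List Bool) : emb (false :: u) < emb (true :: v) :=
  cons_false_lt _ _

@[simp] theorem not_emb_true_lt_false (u v : List Bool) :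
    ¬ emb (true :: u) < emb (false :: v) :=
  not_cons_true_lt _ _

theorem app_eq_app {u v : List Bool} {x y : ZSeq} (h : app u x = app v y)
    (hl : u.length = v.length) : u = v ∧ x = y := by
  induction u generalizing v with
  | nil =>
    cases v with
    | nil => exact ⟨rfl, h⟩
    | cons => simp at hl
  | cons a u ih =>
    cases v with
    | nil => simp at hl
    | cons b v =>
      rw [app_cons, app_cons, cons_eq_cons] at h
      obtain ⟨rfl, h2⟩ := ih h.2 (by simpa using hl)
      exact ⟨by rw [h.1], h2⟩

theorem app_eq_app_of_le {u v : List Bool} {x y : ZSeq} (h : app u x = app v y)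
    (hl : u.length ≤ v.length) : ∃ w, v = u ++ w ∧ x = app w y := by
  induction u generalizing v with
  | nil => exact ⟨v, rfl, h⟩
  | cons a u ih =>
    cases v with
    | nil => simp at hl
    | cons b v =>
      rw [app_cons, app_cons, cons_eq_cons] at h
      obtain ⟨w, rfl, h2⟩ := ih h.2 (by simpa using hl)
      exact ⟨w, by rw [h.1]; rfl, h2⟩

theorem get_app_of_lt {w : List Bool} {x y : ZSeq} {n : ℕ} (h : n < w.length) :
    (app w x).get n = (app w y).get n := by
  induction w generalizing n with
  | nil => simp at h
  | cons b w ih =>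
    cases n with
    | zero => rfl
    | succ n => exact ih (by simpa using h)

theorem get_app_add (w : List Bool) (x : ZSeq) (n : ℕ) :
    (app w x).get (n + w.length) = x.get n := by
  induction w with
  | nil => rfl
  | cons b w ih => simpa [← add_assoc, cons_succ] using ih

/-- If `ρ = rrr⋯` then a sequence below `ρ` increases when `r` is prepended. -/
theorem lt_app_of_lt {r : List Bool} (hr : r ≠ []) {ρ x : ZSeq} (hρ : ρ = app r ρ) (h : x < ρ) :
    x < app r x := by
  obtain ⟨i, h1, h2⟩ := h
  have hr' : 0 < r.length := List.length_pos_iff.2 hr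
  have key : ∀ j ≤ i, (app r x).get j = ρ.get j := by
    intro j hj
    rcases lt_or_ge j r.length with hj' | hj'
    · rw [hρ]; exact get_app_of_lt hj'
    · obtain ⟨k, rfl⟩ := Nat.exists_eq_add_of_le' hj'
      rw [get_app_add]
      conv_rhs => rw [hρ]
      rw [get_app_add]
      exact h1 k (by omega)
  exact ⟨i, fun j hj => (h1 j hj).trans (key j hj.le).symm, lt_of_lt_of_eq h2 (key i le_rfl).symm⟩

theorem app_lt_of_lt {r : List Bool} (hr : r ≠ []) {ρ x : ZSeq} (hρ : ρ = app r ρ) (h : ρ < x) :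
    app r x < x := by
  have hr' : bar r ≠ [] := by simpa [bar] using hr
  have := lt_app_of_lt hr' (ρ := -ρ) (x := -x) (by rw [← neg_app, ← hρ]) (neg_lt_neg_seq.2 h)
  rwa [← neg_app, neg_lt_neg_seq] at this

theorem lt_of_lt_app {r : List Bool} (hr : r ≠ []) {ρ x : ZSeq} (hρ : ρ = app r ρ)
    (h : x < app r x) : x < ρ := by
  rcases lt_trichotomy x ρ with h' | h' | h'
  · exact h'
  · rw [h', ← hρ] at h; exact absurd h (lt_irrefl _)
  · exact absurd (app_lt_of_lt hr hρ h') h.asymm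

theorem lt_of_app_lt {r : List Bool} (hr : r ≠ []) {ρ x : ZSeq} (hρ : ρ = app r ρ)
    (h : app r x < x) : ρ < x := by
  rcases lt_trichotomy x ρ with h' | h' | h'
  · exact absurd (lt_app_of_lt hr hρ h') h.asymm
  · rw [h', ← hρ] at h; exact absurd h (lt_irrefl _)
  · exact h'

theorem eq_of_eq_app {r : List Bool} (hr : r ≠ []) {ρ x : ZSeq} (hρ : ρ = app r ρ)
    (h : x = app r x) : x = ρ := by
  rcases lt_trichotomy x ρ with h' | h' | h'
  · exact absurd h (lt_app_of_lt hr hρ h').ne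
  · exact h'
  · exact absurd h (app_lt_of_lt hr hρ h').ne'

/-- The periodic sequence `rrr⋯`. -/
def per (r : List Bool) : ZSeq := ZSeq.mk fun n => sgn (r.getD (n % r.length) false)

theorem get_app_getD {r : List Bool} {x : ZSeq} {n : ℕ} (h : n < r.length) :
    (app r x).get n = sgn (r.getD n false) := by
  induction r generalizing n with
  | nil => simp at h
  | cons b r ih =>
    cases n with
    | zero => rfl
    | succ n => simpa [cons_succ] using ih (by simpa using h)

theorem per_eq {r : List Bool} (hr : r ≠ []) : per r = app r (per r) := by
  have hr' : 0 < r.length := List.length_pos_iff.2 hr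
  refine ZSeq.ext fun n => ?_
  rcases lt_or_ge n r.length with hn | hn
  · rw [get_app_getD hn]
    simp [per, Nat.mod_eq_of_lt hn]
  · obtain ⟨k, rfl⟩ := Nat.exists_eq_add_of_le' hn
    rw [get_app_add]
    simp [per]

/-- A period can be stripped from a finite word only finitely often. Hence comparisons of words with
ω are always strict. -/
theorem emb_ne_of_eq_app {r : List Bool} (hr : r ≠ []) {ρ : ZSeq} (hρ : ρ = app r ρ)
    (w : List Bool) : emb w ≠ ρ := by
  intro h
  suffices ∀ n, ∀ w : List Bool, w.length = n → emb w ≠ ρ from this _ w rfl h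
  intro n
  induction n using Nat.strong_induction_on with
  | _ n ih =>
    rintro w rfl h
    rw [hρ] at h
    obtain ⟨v, rfl, hv⟩ := emb_eq_app h
    refine ih v.length ?_ v rfl hv.symm
    have := List.length_pos_iff.2 hr
    simp; omega

/-! ### Lexical words and the sequence `p0p0p0⋯` -/

/-- A word is lexical if it exceeds its proper suffixes and their complements. -/
def Lexi (w : List Bool) : Prop :=
  ∀ g s, w = g ++ s → g ≠ [] → emb s < emb w ∧ -emb s < emb w

/-- The sequence `p0p0p0⋯`. -/
def om (p : List Bool) : ZSeq := per (p ++ [false])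

/-- All suffixes of `w`, and their complements, are below `p0p0p0⋯`. -/
def Adm (p w : List Bool) : Prop := ∀ s, s <:+ w → emb s < om p ∧ -emb s < om p

/-- No `p0⋯` has a suffix of `p` with complement `p1⋯`. -/
def NonDoubling (p : List Bool) : Prop :=
  ∀ g z, p = g ++ z → g ≠ [] → ∀ y, app (bar z) (cons true (-om p)) < app p y

theorem om_eq (p : List Bool) : om p = app p (cons false (om p)) := by
  conv_lhs => rw [om, per_eq (by simp)]
  simp [om]

theorem om_eq' (p : List Bool) : om p = app (p ++ [false]) (om p) := by
  conv_lhs => rw [om_eq]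
  simp

theorem suffix_append_cases {s a b : List Bool} (h : s <:+ a ++ b) :
    s <:+ b ∨ ∃ e, e <:+ a ∧ s = e ++ b := by
  obtain ⟨t, ht⟩ := h
  rcases List.append_eq_append_iff.1 ht with ⟨c, rfl, rfl⟩ | ⟨c, rfl, rfl⟩
  · exact Or.inr ⟨c, ⟨t, rfl⟩, rfl⟩
  · exact Or.inl ⟨c, rfl⟩

theorem suffix_append_cons_cases {s a b : List Bool} {c : Bool} (h : s <:+ a ++ c :: b) :
    s <:+ b ∨ ∃ e, e <:+ a ∧ s = e ++ c :: b := by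
  rcases suffix_append_cases h with h | h
  · rcases List.suffix_cons_iff.1 h with rfl | h
    · exact Or.inr ⟨[], List.nil_suffix, rfl⟩
    · exact Or.inl h
  · exact Or.inr h

theorem word_trichotomy {c p : List Bool} (h : c.length ≤ p.length) :
    (∀ x y, app c x < app p y) ∨ (∃ d, p = c ++ d) ∨ ∀ x y, app p y < app c x := by
  induction c generalizing p with
  | nil => exact Or.inr (Or.inl ⟨p, rfl⟩)
  | cons a c ih =>
    cases p with
    | nil => simp at h
    | cons b p =>
      cases a <;> cases b
      · simpa using ih (by simpa using h)
      · exact Or.inl fun x y => by simp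
      · exact Or.inr (Or.inr fun x y => by simp)
      · simpa using ih (by simpa using h)

theorem Lexi.exists_true {w : List Bool} (h : Lexi w) (hw : w ≠ []) : ∃ v, w = true :: v := by
  have := (h w [] (by simp) hw).1
  cases w with
  | nil => exact absurd rfl hw
  | cons b w =>
    cases b
    · exact absurd this (cons_false_lt_zero _).asymm
    · exact ⟨w, rfl⟩

theorem app_false_lt_of_emb_lt {c p : List Bool} (hl : c.length < p.length)
    (h : emb c < emb p) (x y : ZSeq) : app c (cons false x) < app p y := by
  rcases word_trichotomy hl.le with h' | ⟨d, rfl⟩ | h'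
  · exact h' _ _
  · rw [emb_append] at h
    have h0 : (0 : ZSeq) < emb d := app_lt_app.1 h
    match d with
    | [] => simp at hl
    | true :: d => simp
    | false :: d => exact absurd h0 (cons_false_lt_zero _).asymm
  · exact absurd h (h' _ _).asymm

section
variable {p : List Bool}

theorem Lexi.suffix_false_lt (hp : Lexi p) {g z : List Bool} (h : p = g ++ z) (hg : g ≠ [])
    (x y : ZSeq) : app z (cons false x) < app p y :=
  app_false_lt_of_emb_lt (by have := List.length_pos_iff.2 hg; simp [h]; omega)
    (hp g z h hg).1 x y

theorem Lexi.bar_suffix_false_lt (hp : Lexi p) {g z : List Bool} (h : p = g ++ z) (hg : g ≠ [])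
    (x y : ZSeq) : app (bar z) (cons false x) < app p y :=
  app_false_lt_of_emb_lt (by have := List.length_pos_iff.2 hg; simp [h]; omega)
    (by simpa using (hp g z h hg).2) x y

/-- Used to exclude a letter 1 directly before p in words bounded by ω. If p = 1q, the suffix q
followed by 0 is below p. -/
theorem Lexi.lt_true_app (hp : Lexi p) (x y : ZSeq) :
    app p (cons false y) < cons true (app p x) := by
  by_cases h : p = []
  · subst h; simp
  · obtain ⟨q, rfl⟩ := hp.exists_true h
    have := hp.suffix_false_lt (g := [true]) (z := q) rfl (by simp) y x
    simpa using this

theorem om_tail {e : List Bool} {y : ZSeq} (h : om p = app e y) : ∃ b w, y = cons b w := by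
  have h1 : y.get 0 = (om p).get e.length := by
    rw [h]; simpa using (get_app_add e y 0).symm
  exact ⟨_, ZSeq.exists_cons (h1.trans rfl)⟩

/-- A tail of `p0p0⋯` which follows a letter `1`. -/
theorem om_tail_true (hA2 : NonDoubling p) {e : List Bool} {w : ZSeq}
    (h : om p = app e (cons true w)) (y : ZSeq) : -w < app p y := by
  induction hn : e.length using Nat.strong_induction_on generalizing e with
  | _ n ih =>
    subst hn
    rcases lt_or_ge e.length (p ++ [false]).length with hl | hl
    · have h1 : app (e ++ [true]) w = app (p ++ [false]) (om p) := by
        rw [← om_eq', h]; simp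
      obtain ⟨r, hr, rfl⟩ := app_eq_app_of_le h1 (by simpa using hl)
      rcases List.eq_nil_or_concat' r with rfl | ⟨r, b, rfl⟩
      · simp at hr
      · rw [← List.append_assoc] at hr
        obtain ⟨hr1, hr2⟩ := List.append_inj' hr rfl
        obtain rfl : false = b := by simpa using hr2
        have := hA2 _ _ hr1 (by simp) y
        simpa using this
    · have h1 : app (p ++ [false]) (om p) = app e (cons true w) := by rw [← om_eq', h]
      obtain ⟨e', rfl, h2⟩ := app_eq_app_of_le h1 hl
      exact ih _ (by simp; omega) h2 rfl

/-- A tail of `p0p0⋯` which follows a letter `0`. -/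
theorem om_tail_false (hp : Lexi p) {e : List Bool} {w : ZSeq}
    (h : om p = app e (cons false w)) : (w = om p ∧ p <:+ e) ∨ ∀ y, w < app p y := by
  induction hn : e.length using Nat.strong_induction_on generalizing e with
  | _ n ih =>
    subst hn
    rcases lt_or_ge e.length (p ++ [false]).length with hl | hl
    · have h1 : app (e ++ [false]) w = app (p ++ [false]) (om p) := by
        rw [← om_eq', h]; simp
      obtain ⟨r, hr, rfl⟩ := app_eq_app_of_le h1 (by simpa using hl)
      rcases List.eq_nil_or_concat' r with rfl | ⟨r, b, rfl⟩
      · have : p = e := List.append_cancel_right (bs := [false]) (by simpa using hr)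
        exact Or.inl ⟨rfl, by rw [this]⟩
      · rw [← List.append_assoc] at hr
        obtain ⟨hr1, hr2⟩ := List.append_inj' hr rfl
        obtain rfl : false = b := by simpa using hr2
        refine Or.inr fun y => ?_
        have := hp.suffix_false_lt hr1 (by simp) (om p) y
        simpa using this
    · have h1 : app (p ++ [false]) (om p) = app e (cons false w) := by rw [← om_eq', h]
      obtain ⟨e', rfl, h2⟩ := app_eq_app_of_le h1 hl
      rcases ih _ (by simp; omega) h2 rfl with h | h
      · exact Or.inl ⟨h.1, h.2.trans (List.suffix_append _ _)⟩
      · exact Or.inr h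

theorem Adm.of_suffix {w v : List Bool} (h : Adm p w) (hv : v <:+ w) : Adm p v :=
  fun s hs => h s (hs.trans hv)

theorem Adm.bar {w : List Bool} (h : Adm p w) : Adm p (bar w) := fun s hs => by
  have := h (LexSeq.bar s) (by simpa using bar_suffix hs)
  simpa [and_comm] using this

theorem adm_bar {w : List Bool} : Adm p (bar w) ↔ Adm p w :=
  ⟨fun h => by simpa using h.bar, Adm.bar⟩

theorem Adm.lt {w : List Bool} (h : Adm p w) : emb w < om p := (h w List.suffix_rfl).1

theorem Adm.neg_lt {w : List Bool} (h : Adm p w) : -emb w < om p := (h w List.suffix_rfl).2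

/-- If ω continues `e`, then `e` < ω makes the continuation positive, so it begins with 1. -/
theorem app_false_lt_om {e : List Bool} (h : emb e < om p) (x : ZSeq) :
    app e (cons false x) < om p := by
  rcases app_trichotomy e (om p) with h' | ⟨y, hy⟩ | h'
  · exact h' _
  · rw [hy] at h ⊢
    exact app_lt_app.2 ((cons_false_lt_zero x).trans (app_lt_app.1 h))
  · exact absurd h (h' _).asymm

/-- If ω continues `e`, its next letter is 1, and what comes after that exceeds the negative of
every p⋯ by `om_tail_true`. -/
theorem app_true_lt_om (hA2 : NonDoubling p) {e : List Bool} (h : emb e < om p) {y x : ZSeq}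
    (hx : x ≤ -app p y) : app e (cons true x) < om p := by
  rcases app_trichotomy e (om p) with h' | ⟨u, hu⟩ | h'
  · exact h' _
  · obtain ⟨b, w, rfl⟩ := om_tail hu
    cases b
    · rw [hu] at h
      exact absurd (app_lt_app.1 h) (cons_false_lt_zero _).asymm
    · have := om_tail_true hA2 hu y
      rw [hu]
      simpa using hx.trans_lt (neg_lt_seq.1 this)
  · exact absurd h (h' _).asymm

theorem app_true_neg_om_lt (hA2 : NonDoubling p) {e : List Bool} (h : emb e < om p) :
    app e (cons true (-om p)) < om p :=
  app_true_lt_om hA2 h (y := cons false (om p)) (by rw [← om_eq])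

/-- Admissibility survives cutting off 0p⋯. The danger is that ω continues a suffix `s` by 0: then
the tail of ω is ω itself, which needs p as a suffix of `s`, or it is below every p⋯, against the
hypothesis on `s` followed by 0p⋯. -/
theorem adm_of_false (hp : Lexi p) {y : List Bool} {x : ZSeq}
    (h : ∀ e, e <:+ y → app e (cons false (app p x)) < om p ∧
      app (bar e) (cons true (-app p x)) < om p) (hns : ¬ p <:+ y) : Adm p y := by
  intro s hs
  obtain ⟨h1, h2⟩ := h s hs
  constructor
  · rcases app_trichotomy s (om p) with h' | ⟨u, hu⟩ | h'
    · exact h' _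
    · obtain ⟨b, w, rfl⟩ := om_tail hu
      cases b
      · rcases om_tail_false hp hu with h' | h'
        · exact absurd (h'.2.trans hs) hns
        · rw [hu] at h1
          exact absurd (cons_lt_cons.1 (app_lt_app.1 h1)) (h' x).asymm
      · rw [hu]; exact app_lt_app.2 (zero_lt_cons_true _)
    · exact absurd h1 (h' _).asymm
  · rw [neg_emb]
    rcases app_trichotomy (bar s) (om p) with h' | ⟨u, hu⟩ | h'
    · exact h' _
    · obtain ⟨b, w, rfl⟩ := om_tail hu
      cases b
      · rw [hu] at h2
        exact absurd (app_lt_app.1 h2) (not_cons_true_lt _ _)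
      · rw [hu]; exact app_lt_app.2 (zero_lt_cons_true _)
    · exact absurd h2 (h' _).asymm

theorem adm_of_true (hp : Lexi p) {y : List Bool} {x : ZSeq}
    (h : ∀ e, e <:+ y → app (bar e) (cons false (app p x)) < om p ∧
      app e (cons true (-app p x)) < om p) (hns : ¬ bar p <:+ y) : Adm p y := by
  rw [← adm_bar]
  refine adm_of_false hp (x := x) (fun e he => ?_) fun h' => hns ?_
  · simpa using h (bar e) (by simpa using bar_suffix he)
  · simpa using bar_suffix h'

theorem Adm.append_true (hA2 : NonDoubling p) {y W : List Bool} (hy : Adm p y)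
    (hW : Adm p (p ++ W)) : Adm p (y ++ true :: LexSeq.bar (p ++ W)) := by
  intro s hs
  rcases suffix_append_cons_cases hs with hs | ⟨e, he, rfl⟩
  · exact hW.bar s hs
  · obtain ⟨h1, h2⟩ := hy e he
    constructor
    · have := app_true_lt_om hA2 h1 (y := emb W) (x := -app p (emb W)) le_rfl
      simpa using this
    · have := app_false_lt_om (e := LexSeq.bar e) (by simpa using h2) (emb (p ++ W))
      simpa using this

theorem suffix_eq_or_proper {e p : List Bool} (h : e <:+ p) :
    e = p ∨ ∃ g, p = g ++ e ∧ g ≠ [] := by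
  obtain ⟨g, rfl⟩ := h
  by_cases hg : g = []
  · left; simp [hg]
  · exact Or.inr ⟨g, rfl, hg⟩

theorem Lexi.suffix_false_lt_om (hp : Lexi p) {e : List Bool} (h : e <:+ p) {x : ZSeq}
    (hx : x < om p) : app e (cons false x) < om p := by
  rcases suffix_eq_or_proper h with rfl | ⟨g, hg, hg'⟩
  · rw [om_eq]; simpa using hx
  · rw [om_eq]; exact hp.suffix_false_lt hg hg' _ _

/-- For a suffix e of p, the bound on e0X' needs only X' < ω, and its negative decreases when X is
raised. -/
theorem Adm.mono (hp : Lexi p) {X X' : List Bool} (h : Adm p (p ++ false :: X))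
    (h' : Adm p X') (hle : emb X ≤ emb X') : Adm p (p ++ false :: X') := by
  intro s hs
  rcases suffix_append_cons_cases hs with hs | ⟨e, he, rfl⟩
  · exact h' s hs
  · constructor
    · rw [emb_append, emb_cons]
      exact hp.suffix_false_lt_om he h'.lt
    · have h1 := (h (e ++ false :: X) (by
        obtain ⟨g, rfl⟩ := he; exact ⟨g, by simp⟩)).2
      refine lt_of_le_of_lt ?_ h1
      rw [neg_le_neg_seq, emb_append, emb_append, emb_cons, emb_cons]
      exact app_le_app.2 (cons_le_cons.2 hle)

theorem lt_block {x : ZSeq} (h : x < om p) : x < app p (cons false x) := by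
  have := lt_app_of_lt (r := p ++ [false]) (by simp) (om_eq' p) h
  simpa using this

theorem lt_om_of_lt_block {x : ZSeq} (h : x < app p (cons false x)) : x < om p :=
  lt_of_lt_app (r := p ++ [false]) (by simp) (om_eq' p) (by simpa using h)

theorem block_lt_om {x : ZSeq} : app p (cons false x) < om p ↔ x < om p := by
  conv_lhs => rw [om_eq]
  simp

theorem om_lt_block {x : ZSeq} : om p < app p (cons false x) ↔ om p < x := by
  conv_lhs => lhs; rw [om_eq]
  simp

theorem om_lt_true (x : ZSeq) : om p < app p (cons true x) := by
  rw [om_eq]; simp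

theorem Adm.block (hp : Lexi p) {X : List Bool} (h : Adm p (p ++ false :: X)) :
    Adm p (p ++ false :: (p ++ false :: X)) :=
  h.mono hp h (by
    rw [emb_append p, emb_cons]
    exact (lt_block (h.of_suffix ⟨p ++ [false], by simp⟩).lt).le)

/-- From t < p0t periodicity gives t < ω, hence p0t < ω; bounds by the word itself are therefore
bounds by ω. -/
theorem Lexi.adm {t : List Bool} (h : Lexi (p ++ false :: t)) : Adm p (p ++ false :: t) := by
  have ht : emb t < om p := by
    have := (h (p ++ [false]) t (by simp) (by simp)).1
    rw [emb_append, emb_cons] at this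
    exact lt_om_of_lt_block this
  have hw : emb (p ++ false :: t) < om p := by
    rw [emb_append, emb_cons]; exact block_lt_om.2 ht
  intro s hs
  rcases suffix_eq_or_proper hs with rfl | ⟨g, hg, hg'⟩
  · refine ⟨hw, ?_⟩
    have h0 := (h _ [] (List.append_nil _).symm (by simp)).1
    have : -emb (p ++ false :: t) < 0 := by
      have := neg_lt_neg_seq.2 h0
      simpa [emb_nil] using this
    exact this.trans (h0.trans hw)
  · exact ⟨(h g s hg hg').1.trans hw, (h g s hg hg').2.trans hw⟩

/-- Let x = z̄1(-ω); it is below ω because z̄1t̄ < p0t and -ω < -t. If x began with p, then -ω = ḡx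
would make x periodic with period z̄1ḡ = pc for a letter c. Here c = 0 gives x = ω and c = 1 gives x
> ω. -/
theorem Lexi.nonDoubling {t : List Bool} (h : Lexi (p ++ false :: t)) : NonDoubling p := by
  intro g z hgz hg y
  have hadm := h.adm
  have hlt : app (bar z) (cons true (-om p)) < om p := by
    have h1 := (h g (z ++ false :: t) (by simp [hgz]) hg).2
    refine lt_trans ?_ (h1.trans hadm.lt)
    have h2 := neg_lt_neg_seq.2 (hadm.of_suffix (v := t) ⟨p ++ [false], by simp⟩).lt
    rw [emb_append, emb_cons, neg_app, neg_cons]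
    exact app_lt_app.2 (cons_lt_cons.2 h2)
  rcases app_trichotomy p (app (bar z) (cons true (-om p))) with h' | ⟨x, hx⟩ | h'
  · have := h' (cons false (om p))
    rw [← om_eq] at this
    exact absurd this hlt.asymm
  · have hom : -om p = app (bar g) (app (bar z) (cons true (-om p))) := by
      conv_lhs => rw [om_eq]
      rw [neg_app, ← app_append, ← bar_append, ← hgz]
      simp
    have hcyc : app p x = app (bar z ++ true :: bar g) (app (bar z) (cons true (-om p))) := by
      rw [← hx]
      conv_lhs => rw [hom]
      simp
    obtain ⟨w, hw, rfl⟩ := app_eq_app_of_le hcyc (by simp [hgz]; omega)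
    have hlen : w.length = 1 := by
      have := congrArg List.length hw
      simp [hgz] at this
      omega
    obtain ⟨c, rfl⟩ := List.length_eq_one_iff.1 hlen
    cases c
    · have := eq_of_eq_app (r := p ++ [false]) (by simp) (om_eq' p)
        (x := app (bar z) (cons true (-om p))) (by simpa using hx)
      exact absurd this hlt.ne
    · rw [hx] at hlt
      exact absurd (om_lt_true _) hlt.asymm
  · exact h' y

theorem emb_lt_of_app_true_lt {c : List Bool} (hl : c.length < p.length) {x y : ZSeq}
    (h : app c (cons true x) < app p y) : emb c < emb p := by
  rcases word_trichotomy hl.le with h' | ⟨d, rfl⟩ | h'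
  · exact h' _ _
  · rw [emb_append]
    refine app_lt_app.2 ?_
    match d with
    | [] => simp at hl
    | true :: d => exact zero_lt_cons_true _
    | false :: d => simp at h
  · exact absurd h (h' _ _).asymm

/-- A shorter word which is below p⋯ when followed by 1 is itself below p. Apply this to z1s < p1s
and, for the complement, to z̄1t̄ < p0t. -/
theorem Lexi.of_prefix {s t : List Bool} (h : Lexi (p ++ false :: t))
    (h' : Lexi (p ++ true :: s)) : Lexi p := by
  intro g z hgz hg
  have hl : z.length < p.length := by
    have := List.length_pos_iff.2 hg
    simp [hgz]; omega
  constructor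
  · have := (h' g (z ++ true :: s) (by simp [hgz]) hg).1
    rw [emb_append, emb_append, emb_cons] at this
    exact emb_lt_of_app_true_lt hl this
  · have := (h g (z ++ false :: t) (by simp [hgz]) hg).2
    rw [emb_append, emb_append, emb_cons, neg_app, neg_cons] at this
    rw [neg_emb]
    exact emb_lt_of_app_true_lt (by simpa using hl) this
end

/-! ### Interpolation of admissible words, and the greatest admissible continuation -/

section
variable {p : List Bool}

theorem om_exists_prefix (p : List Bool) (j : ℕ) :
    ∃ o w, o.length = j ∧ om p = app o w := by
  induction j with
  | zero => exact ⟨[], om p, rfl, rfl⟩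
  | succ j ih =>
    obtain ⟨o, w, rfl, h⟩ := ih
    obtain ⟨b, w', rfl⟩ := om_tail h
    exact ⟨o ++ [b], w', by simp, by simpa using h⟩

theorem om_tail_get_le {e : List Bool} {y : ZSeq} (h : om p = app e y) (n : ℕ) :
    y.get n ≤ 1 ∧ -1 ≤ y.get n := by
  have h1 : y.get n = (om p).get (n + e.length) := by rw [h, get_app_add]
  rw [h1]
  change sgn _ ≤ 1 ∧ -1 ≤ sgn _
  unfold sgn
  split <;> simp

theorem le_cons_true {x : ZSeq} (h : ∀ n, x.get n ≤ 1) : x ≤ cons true x := by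
  by_contra hlt
  obtain ⟨i, -, hi⟩ := lt_of_app_lt (r := [true]) (by simp) (per_eq (by simp))
    (by simpa using not_le.1 hlt)
  have : (per [true]).get i = 1 := by
    change sgn (List.getD [true] (i % 1) false) = 1
    simp [Nat.mod_one, sgn]
  exact absurd (h i) (not_le.2 (this ▸ hi))

theorem Adm.ne_nil {w : List Bool} (h : Adm p w) : p ≠ [] := by
  rintro rfl
  have h1 := (h [] List.nil_suffix).1
  rw [om_eq] at h1
  exact absurd h1 (cons_false_lt_zero _).asymm

/-- This makes ω weakly admissible, so that pieces of ω and -ω can serve as trial continuations in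
`exists_adm_append`. -/
theorem om_tail_le (hp : Lexi p) (hA2 : NonDoubling p) (hne : p ≠ []) {e : List Bool} {y : ZSeq}
    (h : om p = app e y) : y ≤ om p ∧ -y ≤ om p := by
  induction e using List.reverseRecOn generalizing y with
  | nil =>
    obtain rfl : om p = y := h
    refine ⟨le_rfl, ?_⟩
    obtain ⟨q, hq⟩ := hp.exists_true hne
    rw [om_eq, hq]
    simpa using (cons_false_lt _ _).le
  | append_singleton e b ih =>
    have h' : om p = app e (cons b y) := by simpa using h
    obtain ⟨h1, h2⟩ := ih h'
    have hle := om_tail_get_le h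
    cases b
    · constructor
      · rcases om_tail_false hp h' with h3 | h3
        · exact h3.1.le
        · have := h3 (cons false (om p))
          rw [← om_eq] at this
          exact this.le
      · refine (le_cons_true fun n => ?_).trans (by simpa using h2)
        have := (hle n).2
        simp; omega
    · constructor
      · exact (le_cons_true fun n => (hle n).1).trans h1
      · have := om_tail_true hA2 h' (cons false (om p))
        rw [← om_eq] at this
        exact this.le

/-- The sequences `app e x`, for the suffixes `e` of `w`, and their negatives are at most
`p0p0p0⋯`. -/
def AdmLE (p w : List Bool) (x : ZSeq) : Prop :=
  ∀ e, e <:+ w → app e x ≤ om p ∧ -app e x ≤ om p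

theorem AdmLE.cons_emb_lt {c d : List Bool} {x : ZSeq} {b : Bool}
    (h : AdmLE p (c ++ b :: d) x) {e : List Bool} (he : e <:+ c) :
    if b then emb e < om p else -emb e < om p := by
  obtain ⟨h1, h2⟩ := h (e ++ b :: d) (by obtain ⟨g, rfl⟩ := he; exact ⟨g, by simp⟩)
  rw [app_append] at h1 h2
  cases b
  · refine lt_of_lt_of_le ?_ h2
    exact neg_lt_neg_seq.2 (app_lt_app.2 (cons_false_lt_zero _))
  · exact lt_of_lt_of_le (app_lt_app.2 (zero_lt_cons_true _)) h1

/-- Between an initial bound which `v` exceeds and a final one which it does not, there is an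
admissible word with suffix `v`. -/
theorem exists_adm_append (hp : Lexi p) (hA2 : NonDoubling p) (hne : p ≠ []) {v : List Bool}
    (hv : Adm p v) : ∀ (j : ℕ) (c da db : List Bool) (a b : ZSeq), da.length = j →
    db.length = j → (a < emb v ∧ -a < emb v) → ¬ (b < emb v ∧ -b < emb v) →
    AdmLE p (c ++ da) a → AdmLE p (c ++ db) b → app da a < app db b →
    ∃ D, D.length = c.length + j ∧ Adm p (D ++ v) ∧ app (c ++ da) a < emb (D ++ v) := by
  -- A discrete intermediate value argument. Call x good if x < v and -x < v; a good lower and a bad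
  -- upper bound are kept, and letters on which they agree move into `c`.
  intro j
  induction j with
  | zero =>
    intro c da db a b hda hdb ha hb hsa hsb hab
    obtain rfl := List.length_eq_zero_iff.1 hda
    obtain rfl := List.length_eq_zero_iff.1 hdb
    rw [List.append_nil] at hsa hsb ⊢
    have hvb : emb v ≤ b := by
      by_contra h
      rw [not_le] at h
      refine hb ⟨h, ?_⟩
      rw [app_nil, app_nil] at hab
      exact (neg_lt_neg_seq.2 hab).trans ha.2
    refine ⟨c, by simp, ?_, by rw [emb_append]; exact app_lt_app.2 ha.1⟩
    intro s hs
    rcases suffix_append_cases hs with hs | ⟨e, he, rfl⟩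
    · exact hv s hs
    · constructor
      · refine lt_of_le_of_ne ?_ (emb_ne_of_eq_app (by simp) (om_eq' p) _)
        rw [emb_append]
        exact (app_le_app.2 hvb).trans (hsb e he).1
      · refine lt_of_lt_of_le ?_ (hsa e he).2
        rw [emb_append]
        exact neg_lt_neg_seq.2 (app_lt_app.2 ha.1)
  | succ j ih =>
    intro c da db a b hda hdb ha hb hsa hsb hab
    obtain ⟨x, da, rfl⟩ := List.exists_cons_of_length_eq_add_one hda
    obtain ⟨y, db, rfl⟩ := List.exists_cons_of_length_eq_add_one hdb
    simp only [List.length_cons, Nat.add_right_cancel_iff] at hda hdb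
    by_cases hxy : x = y
    · subst hxy
      obtain ⟨D, h1, h2, h3⟩ := ih (c ++ [x]) da db a b hda hdb ha hb (by simpa using hsa)
        (by simpa using hsb) (by simpa using hab)
      exact ⟨D, by rw [h1]; simp; omega, h2, by simpa using h3⟩
    · obtain ⟨rfl, rfl⟩ : x = false ∧ y = true := by
        cases x <;> cases y <;> simp_all
      -- The bounds part as 0 < 1, and c0ω and c1(-ω) lie between them. Write ω = ow. If w is good,
      -- so is -w, and c1(-ω) is a new lower bound; otherwise c0ω is a new upper bound.
      obtain ⟨o, w, ho, how⟩ := om_exists_prefix p j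
      have hneg : -om p = app (bar o) (-w) := by rw [how, neg_app]
      have he1 : ∀ e, e <:+ c → emb e < om p := fun e he => by simpa using hsb.cons_emb_lt he
      have he2 : ∀ e, e <:+ c → emb (bar e) < om p := fun e he => by
        simpa using hsa.cons_emb_lt he
      have hshift : ∀ e, e <:+ o → app e w ≤ om p ∧ -app e w ≤ om p := by
        rintro e ⟨g, rfl⟩
        exact om_tail_le hp hA2 hne (e := g) (by simpa using how)
      by_cases hw : w < emb v ∧ -w < emb v
      · have hsm : AdmLE p (c ++ [true] ++ bar o) (-w) := by
          intro e he
          rw [List.append_assoc, List.singleton_append] at he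
          rcases suffix_append_cons_cases he with he | ⟨e, he', rfl⟩
          · have := hshift (bar e) (by simpa using bar_suffix he)
            simpa [and_comm] using this
          · rw [app_append, app_cons, ← hneg]
            constructor
            · exact (app_true_neg_om_lt hA2 (he1 e he')).le
            · simpa using (app_false_lt_om (he2 e he') (om p)).le
        obtain ⟨D, h1, h2, h3⟩ := ih (c ++ [true]) (bar o) db (-w) b (by simpa using ho) hdb
          (by simpa [and_comm] using hw) hb hsm (by simpa using hsb) (by
            rw [← hneg]
            have h4 : -app db b ≤ om p := (hsb db (⟨c ++ [true], by simp⟩)).2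
            rw [← neg_le_neg_seq, neg_neg] at h4
            refine lt_of_le_of_ne h4 fun h5 => ?_
            rw [hneg] at h5
            obtain ⟨-, rfl⟩ := app_eq_app h5 (by simp [ho, hdb])
            exact hb (by simpa [and_comm] using hw))
        refine ⟨D, by rw [h1]; simp; omega, h2, lt_trans ?_ h3⟩
        simp
      · have hsm : AdmLE p (c ++ [false] ++ o) w := by
          intro e he
          rw [List.append_assoc, List.singleton_append] at he
          rcases suffix_append_cons_cases he with he | ⟨e, he', rfl⟩
          · exact hshift e he
          · rw [app_append, app_cons, ← how]
            constructor
            · exact (app_false_lt_om (he1 e he') _).le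
            · simpa using (app_true_neg_om_lt hA2 (he2 e he')).le
        obtain ⟨D, h1, h2, h3⟩ := ih (c ++ [false]) da o a w hda ho ha hw
          (by simpa using hsa) hsm (by
            rw [← how]
            have h4 : app da a ≤ om p := (hsa da (⟨c ++ [false], by simp⟩)).1
            refine lt_of_le_of_ne h4 fun h5 => ?_
            rw [how] at h5
            obtain ⟨-, rfl⟩ := app_eq_app h5 (by simp [ho, hda])
            exact hw ha)
        exact ⟨D, by rw [h1]; simp; omega, h2, by simpa using h3⟩

/-- `M` is the greatest word of its length for which `p0M` is admissible. -/
structure IsMaxAdm (p M : List Bool) : Prop where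
  adm : Adm p (p ++ false :: M)
  le : ∀ X : List Bool, X.length = M.length → Adm p (p ++ false :: X) → emb X ≤ emb M

variable {M : List Bool}

theorem IsMaxAdm.le_of_adm (hp : Lexi p) (h : IsMaxAdm p M) {X : List Bool}
    (hl : X.length = M.length) (hX : Adm p X) : emb X ≤ emb M := by
  by_contra hlt
  exact hlt (h.le X hl (h.adm.mono hp hX (not_le.1 hlt).le))

theorem IsMaxAdm.adm_right (h : IsMaxAdm p M) : Adm p M := h.adm.of_suffix ⟨p ++ [false], by simp⟩

/-- M̄ is admissible too, and it would exceed an M beginning with 0. -/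
theorem IsMaxAdm.head (hp : Lexi p) (h : IsMaxAdm p M) : M = [] ∨ ∃ M', M = true :: M' := by
  match M, h with
  | [], _ => exact Or.inl rfl
  | true :: M, _ => exact Or.inr ⟨M, rfl⟩
  | false :: M, h =>
    have := h.le_of_adm hp (X := bar (false :: M)) (by simp) h.adm_right.bar
    exact absurd (cons_false_lt (emb M) (emb (bar M))) this.not_gt

end

/-! ### The greatest admissible word p0M is lexical -/

section
variable {p M : List Bool}

theorem emb_lt_append_true (v w : List Bool) : emb v < emb (v ++ true :: w) := by
  rw [emb_append]
  exact app_lt_app (w := v) (x := 0).2 (zero_lt_cons_true _)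

theorem append_eq_append_of_le {β : Type*} {a b c d : List β} (h : a ++ b = c ++ d)
    (hl : a.length ≤ c.length) : ∃ e, c = a ++ e ∧ b = e ++ d := by
  rcases List.append_eq_append_iff.1 h with ⟨e, rfl, rfl⟩ | ⟨e, rfl, rfl⟩
  · exact ⟨e, rfl, rfl⟩
  · simp at hl
    subst hl
    exact ⟨[], by simp, by simp⟩

/-- If Y is longer than p, then Y = p0y and M = y0p0v, and y1 followed by the complement of p0v is a
greater admissible continuation. A shorter Y would make p0v begin with a proper suffix of p followed
by 0. -/
theorem IsMaxAdm.false_of_false_block (hp : Lexi p) (hA2 : NonDoubling p) (h : IsMaxAdm p M)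
    {Y v : List Bool} (hY : p ++ false :: M = Y ++ false :: (p ++ false :: v))
    (hns : ¬ p <:+ Y) : False := by
  have hYadm : Adm p Y := by
    refine adm_of_false hp (x := cons false (emb v)) (fun e he => ?_) hns
    have := h.adm (e ++ false :: (p ++ false :: v))
      (by rw [hY]; obtain ⟨g, rfl⟩ := he; exact ⟨g, by simp⟩)
    simpa using this
  rcases lt_trichotomy Y.length p.length with hl | hl | hl
  · obtain ⟨z, hz, hz'⟩ := append_eq_append_of_le hY.symm hl.le
    match z, hz, hz' with
    | [], hz, _ => simp [hz] at hl
    | b :: z, hz, hz' =>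
      obtain ⟨rfl, h1⟩ : false = b ∧ p ++ false :: v = z ++ false :: M := by simpa using hz'
      have := hp.suffix_false_lt (g := Y ++ [false]) (z := z) (by simp [hz]) (by simp)
        (emb M) (cons false (emb v))
      simp [h1] at this
  · obtain ⟨z, hz, hz'⟩ := append_eq_append_of_le hY.symm hl.le
    have : z = [] := by
      have := congrArg List.length hz
      simpa [hl] using this
    simp [this] at hz
    exact hns (by simp [hz])
  · obtain ⟨z, rfl, hz'⟩ := append_eq_append_of_le hY hl.le
    match z, hz' with
    | [], _ => simp at hl
    | b :: y, hz' =>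
      obtain ⟨rfl, rfl⟩ : false = b ∧ M = y ++ false :: (p ++ false :: v) := by simpa using hz'
      have h1 := hYadm.append_true hA2 (W := false :: v)
        (h.adm.of_suffix ⟨p ++ false :: y ++ [false], by simp⟩)
      have h2 := h.le (y ++ true :: bar (p ++ false :: v)) (by simp) (by simpa using h1)
      rw [emb_append, emb_append, app_le_app] at h2
      exact absurd (cons_false_lt _ _) h2.not_gt

/-- Always an admissible word of length |M| above M is produced. If Y = p0y, exchange the two sides
of the 1: v1 followed by the complement of p0y exceeds v ≥ M. If Y is shorter than p, the overlap
gives p = Y1z = z̄1w̄ and M = w1v̄. -/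
theorem IsMaxAdm.false_of_true_block (hp : Lexi p) (hA2 : NonDoubling p) (h : IsMaxAdm p M)
    {Y v : List Bool} (hY : p ++ false :: M = Y ++ true :: bar (p ++ false :: v))
    (hMv : emb M ≤ emb v) (hns : ¬ bar p <:+ Y) : False := by
  have hYadm : Adm p Y := by
    refine adm_of_true hp (x := cons false (emb v)) (fun e he => ?_) hns
    have := h.adm (e ++ true :: bar (p ++ false :: v))
      (by rw [hY]; obtain ⟨g, rfl⟩ := he; exact ⟨g, by simp⟩)
    simpa [and_comm] using this
  have hpv : Adm p (p ++ false :: v) := by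
    rw [← adm_bar]
    exact h.adm.of_suffix ⟨Y ++ [true], by simp [hY]⟩
  have hv : Adm p v := hpv.of_suffix ⟨p ++ [false], by simp⟩
  have hlen := congrArg List.length hY
  simp at hlen
  rcases lt_or_ge Y.length p.length with hl | hl
  swap
  · obtain ⟨z, rfl, hz'⟩ := append_eq_append_of_le hY hl
    match z, hz' with
    | [], hz' => simp at hz'
    | b :: y, hz' =>
      obtain ⟨rfl, hM⟩ : false = b ∧ M = y ++ true :: bar (p ++ false :: v) := by
        simpa using hz'
      have h1 := hpv.append_true hA2 (W := false :: y) hYadm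
      have h2 := h.le (v ++ true :: bar (p ++ false :: y)) (by simp [hM]; omega)
        (by simpa using h1)
      exact absurd (hMv.trans_lt (emb_lt_append_true v _)) h2.not_gt
  obtain ⟨z, hz, hz'⟩ := append_eq_append_of_le hY.symm hl.le
  obtain ⟨z, rfl, hzM⟩ : ∃ z', z = true :: z' ∧ bar (p ++ false :: v) = z' ++ false :: M := by
    match z, hz, hz' with
    | [], hz, _ => simp [hz] at hl
    | b :: z, hz, hz' =>
      obtain ⟨rfl, h1⟩ : true = b ∧ bar (p ++ false :: v) = z ++ false :: M := by simpa using hz'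
      exact ⟨z, rfl, h1⟩
  have hzl : z.length < p.length := by simp [hz]; omega
  obtain ⟨r, hr, hr'⟩ := append_eq_append_of_le (a := z) (c := bar p) (b := false :: M)
    (d := true :: bar v) (by rw [← hzM]; simp) (by simpa using hzl.le)
  obtain ⟨w, rfl, hM⟩ : ∃ w, r = false :: w ∧ M = w ++ true :: bar v := by
    match r, hr, hr' with
    | [], hr, hr' => simp at hr'
    | b :: w, _, hr' =>
      obtain ⟨rfl, h1⟩ : false = b ∧ M = w ++ true :: bar v := by simpa using hr'
      exact ⟨w, rfl, h1⟩
  have hp2 : p = bar z ++ true :: bar w := by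
    rw [← bar_bar p, hr]; simp
  have hbp : bar p = bar Y ++ false :: bar z := by rw [hz]; simp
  have hpz : ∀ x, app p x = app Y (cons true (app z x)) := fun x => by
    conv_lhs => rw [show app p = app (Y ++ true :: z) by rw [← hz]]
    simp
  have hwl : w.length = Y.length := by
    have h1 := congrArg List.length hz
    have h2 := congrArg List.length hp2
    simp at h1 h2
    omega
  have hne : p ≠ [] := by rw [hz]; simp
  -- If w were a prefix of p, it would be Y; then z̄1(-ω) would begin with z̄1w̄ = p, against
  -- `NonDoubling`.
  have hMp : ∀ x y, app w x < app p y := by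
    rcases word_trichotomy (c := w) (p := p) (by omega) with h1 | ⟨d, hd⟩ | h1
    · exact h1
    · have hwY : w = Y := List.append_inj_left (hd.symm.trans hz) hwl
      subst hwY
      have h2 := hA2 (w ++ [true]) z (by simp [hz]) (by simp)
        (cons false (app (bar z) (cons true (-om p))))
      have h3 : -om p = app (bar w) (cons false (app (bar z) (cons true (-om p)))) := by
        conv_lhs => rw [om_eq, neg_app, hbp]
        simp
      conv_lhs at h2 => rw [h3]
      rw [hp2] at h2
      simp at h2
    · have h2 := h.adm_right.lt
      rw [hM, emb_append, om_eq] at h2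
      exact absurd h2 (h1 _ _).asymm
  have hMtrue : ∃ M', M = true :: M' := (h.head hp).resolve_left (by rw [hM]; simp)
  have hMpos : 0 < emb M := by
    obtain ⟨M', hM'⟩ := hMtrue
    rw [hM']; exact zero_lt_cons_true _
  have hvtrue : ∃ v', v = true :: v' := by
    match v, hMv with
    | [], hMv => exact absurd hMpos hMv.not_gt
    | false :: v, hMv => exact absurd (hMpos.trans_le hMv) (cons_false_lt_zero _).asymm
    | true :: v, _ => exact ⟨v, rfl⟩
  -- In the first case v = z̄1u, the word p0ū is admissible and hence p0p0ū is; p0ū has length |M|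
  -- and exceeds M.
  rcases lt_or_ge (app (bar z) (cons true (-om p))) (emb v) with hlt | hge
  · have h1 : app (bar z ++ [true]) (-om p) ≤ emb v := by simpa using hlt.le
    have h2 : emb v < app (bar z ++ [true]) (app (bar w) (cons false (om p))) := by
      have := hv.lt
      rw [om_eq] at this
      conv_rhs at this => rw [show app p = app (bar z ++ true :: bar w) by rw [← hp2]]
      simpa using this
    obtain ⟨y, hy⟩ := exists_app_of_le_of_lt h1 h2
    obtain ⟨u, rfl, -⟩ := emb_eq_app hy
    have hu : Adm p (bar u) := (hv.of_suffix ⟨_, rfl⟩).bar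
    have hzu : Adm p (z ++ false :: bar u) := h.adm_right.of_suffix ⟨w ++ [true], by simp [hM]⟩
    have hpu : Adm p (p ++ false :: bar u) := by
      intro s hs
      have hs' : s <:+ Y ++ true :: (z ++ false :: bar u) := by
        rw [hz] at hs
        simpa using hs
      rcases suffix_append_cons_cases hs' with hs | ⟨e, he, rfl⟩
      · exact hzu s hs
      · constructor
        · have := hp.suffix_false_lt_om (e := e ++ true :: z) (x := emb (bar u))
            (by rw [hz]; obtain ⟨g, rfl⟩ := he; exact ⟨g, by simp⟩) hu.lt
          simpa using this
        · have := app_false_lt_om (p := p) (e := bar e) (by simpa using (hYadm e he).2)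
            (emb (bar (z ++ false :: bar u)))
          simpa using this
    have h3 := h.le (p ++ false :: bar u) (by
      have := congrArg List.length hz
      simp at this
      simp [hM]
      omega) (hpu.block hp)
    refine absurd ?_ h3.not_gt
    rw [hM, emb_append, emb_append]
    exact hMp _ _
  -- Interpolation between w1v̄1(-ω), which exceeds M, and ω = Y1z0ω gives an admissible Dv of
  -- length |M| above M.
  · obtain ⟨v', hv'⟩ := hvtrue
    obtain ⟨D, h1, h2, h3⟩ := exists_adm_append hp hA2 hne hv (w.length + 1) [] (w ++ [true])
      (Y ++ [true]) (app (bar v) (cons true (-om p))) (app z (cons false (om p))) (by simp)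
      (by simp [hwl]) (by
        constructor
        · rw [hv']; simp only [bar_cons, app_cons]; exact cons_false_lt _ _
        · simp only [neg_app, bar_bar, neg_cons, neg_neg]
          exact app_lt_app.2 (cons_false_lt_zero _)) (by
        rintro ⟨-, h4⟩
        simp only [neg_app, neg_cons] at h4
        exact absurd h4 hge.not_gt)
      (by
        intro e he
        have h4 := h.adm_right (e ++ bar v) (by
          obtain ⟨g, hg⟩ := he
          exact ⟨g, by rw [← List.append_assoc, hg, hM]; simp⟩)
        rw [← app_append]
        constructor
        · exact (app_true_neg_om_lt hA2 h4.1).le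
        · rw [neg_app, neg_cons, neg_neg]
          exact (app_false_lt_om (by simpa using h4.2) _).le)
      (by
        rintro e ⟨g, hg⟩
        refine om_tail_le hp hA2 hne (e := g) ?_
        rw [← app_append, hg]
        conv_lhs => rw [om_eq, hpz]
        simp)
      (by
        have h4 := hMp (cons true (app (bar v) (cons true (-om p)))) (cons false (om p))
        rw [hpz] at h4
        simpa using h4)
    have h4 := h.le_of_adm hp (X := D ++ v) (by simp [hM, h1]; omega) h2
    refine absurd (lt_trans ?_ h3) h4.not_gt
    have h5 : emb M < app M (cons true (-om p)) := app_lt_app.2 (zero_lt_cons_true _)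
    simpa [hM] using h5

/-- The word `p0M` is lexical. -/
theorem IsMaxAdm.lexi (hp : Lexi p) (hA2 : NonDoubling p) (h : IsMaxAdm p M) :
    Lexi (p ++ false :: M) := by
  suffices ∀ n, ∀ Y s, p ++ false :: M = Y ++ s → Y ≠ [] → Y.length = n → ∀ c,
      c = s ∨ c = bar s → emb c < emb (p ++ false :: M) by
    intro Y s hY hne
    refine ⟨this _ Y s hY hne rfl s (Or.inl rfl), ?_⟩
    rw [neg_emb]
    exact this _ Y s hY hne rfl _ (Or.inr rfl)
  intro n
  -- A suffix or complement c ≥ p0M lies below ω, so c = p0v with M ≤ v. If it is preceded by a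
  -- further block p0 (or p̄1), the longer suffix gives p0p0v > p0M, which the induction excludes;
  -- otherwise the two preceding lemmas apply.
  induction n using Nat.strong_induction_on with
  | _ n ih =>
    rintro Y s hY hne rfl c hc
    by_contra hlt
    rw [not_lt] at hlt
    have hcadm : Adm p c := by
      have : Adm p s := h.adm.of_suffix ⟨Y, hY.symm⟩
      rcases hc with rfl | rfl
      · exact this
      · exact this.bar
    have h1 : app (p ++ [false]) (emb M) ≤ emb c := by simpa using hlt
    have h2 : emb c < app (p ++ [false]) (om p) := by rw [← om_eq']; exact hcadm.lt
    obtain ⟨y, hy⟩ := exists_app_of_le_of_lt h1 h2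
    obtain ⟨v, hv, -⟩ := emb_eq_app hy
    simp only [List.append_assoc, List.singleton_append] at hv
    subst hv
    have hMv : emb M ≤ emb v := by
      rw [emb_append, emb_append] at hlt
      exact cons_le_cons.1 (app_le_app.1 hlt)
    have hvlt : emb v < emb (p ++ false :: v) := by
      rw [emb_append, emb_cons]
      exact lt_block (hcadm.of_suffix ⟨p ++ [false], by simp⟩).lt
    have hvv : emb (p ++ false :: M) < emb (p ++ false :: (p ++ false :: v)) := by
      rw [emb_append, emb_append, emb_cons, emb_cons]
      exact app_lt_app.2 (cons_lt_cons.2 (hMv.trans_lt hvlt))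
    have hU : ∀ s', cons true (emb (p ++ s')) < om p → False := fun s' hs' => by
      rw [om_eq, emb_append] at hs'
      exact absurd hs' (hp.lt_true_app _ _).asymm
    rcases List.eq_nil_or_concat' Y with rfl | ⟨Y, l, rfl⟩
    · exact hne rfl
    have hls : Adm p (l :: s) := h.adm.of_suffix ⟨Y, by simp [hY]⟩
    rcases hc with rfl | hc
    · cases l
      · refine h.false_of_false_block hp hA2 (Y := Y) (v := v) (by simpa using hY) ?_
        rintro ⟨Y, rfl⟩
        by_cases hYn : Y = []
        · subst hYn
          have : M = p ++ false :: v := by simpa using hY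
          rw [← this] at hvlt
          exact absurd hvlt hMv.not_gt
        · exact absurd (ih Y.length (by simp) Y (p ++ false :: (p ++ false :: v))
            (by rw [hY]; simp) hYn rfl _ (Or.inl rfl)) hvv.asymm
      · exact hU _ hls.lt
    · obtain rfl : s = bar (p ++ false :: v) := by rw [hc, bar_bar]
      cases l
      · exact hU (false :: v) (by simpa using hls.neg_lt)
      · refine h.false_of_true_block hp hA2 (Y := Y) (v := v) (by simpa using hY) hMv ?_
        rintro ⟨Y, rfl⟩
        by_cases hYn : Y = []
        · subst hYn
          obtain ⟨q, hq⟩ := hp.exists_true h.adm.ne_nil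
          rw [hq] at hY
          simp at hY
        · exact absurd (ih Y.length (by simp) Y (bar (p ++ false :: (p ++ false :: v)))
            (by rw [hY]; simp) hYn rfl _ (Or.inr (by rw [bar_bar]))) hvv.asymm

end

/-! ### Lexicality of p1M̄ -/

section
variable {p M : List Bool}

/-- Suffixes inside M̄ are below ω < p1⋯, and ē0⋯ is below p by lexicality of p. Only the suffixes
e1M̄ are left to `hM`. -/
theorem lexi_append_true (hp : Lexi p) {M : List Bool} (h : Adm p M)
    (hM : ∀ g e, p = g ++ e → g ≠ [] →
      app e (cons true (-emb M)) < app p (cons true (-emb M))) :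
    Lexi (p ++ true :: bar M) := by
  intro g s hgs hg
  rcases suffix_append_cons_cases (s := s) ⟨g, hgs.symm⟩ with hs | ⟨e, ⟨g', rfl⟩, rfl⟩
  · obtain ⟨h1, h2⟩ := h.bar s hs
    have h3 : om p < emb (p ++ true :: bar M) := by
      rw [emb_append, emb_cons]; exact om_lt_true _
    exact ⟨h1.trans h3, h2.trans h3⟩
  · have hg' : g = g' := by simpa using hgs.symm
    subst hg'
    constructor
    · have := hM g e rfl hg
      rw [neg_emb, cons_emb, app_emb, app_emb] at this
      exact this
    · have := hp.bar_suffix_false_lt (g := g) (z := e) rfl hg (-emb (bar M))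
        (emb (true :: bar M))
      rw [emb_append, emb_append _ (true :: bar M), emb_cons, neg_app, neg_cons]
      simpa using this

/-- If `p1b̄` is lexical for some `b ≤ M`, then so is `p1M̄`. -/
theorem Lexi.true_bar_of_le (hp : Lexi p) {b : List Bool} (hb : Lexi (p ++ true :: bar b))
    (h : Adm p M) (hle : emb b ≤ emb M) : Lexi (p ++ true :: bar M) := by
  refine lexi_append_true hp h fun g e hge hg => ?_
  have h1 : app e (cons true (-emb b)) < app p (cons true (-emb b)) := by
    have := (hb g (e ++ true :: bar b) (by simp [hge]) hg).1
    simpa using this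
  have hl : e.length < p.length := by
    have := List.length_pos_iff.2 hg
    simp [hge]; omega
  rcases word_trichotomy hl.le with h2 | ⟨d, hd⟩ | h2
  · exact h2 _ _
  · rw [hd] at h1 ⊢
    match d with
    | [] => simp [hd] at hl
    | false :: d => exact absurd h1 (by simp)
    | true :: d =>
      -- This says that -b is below the periodic sequence d1d1⋯, a condition inherited by -M ≤ -b.
      have h3 : -emb b < app (d ++ [true]) (-emb b) := by simpa [-neg_emb] using h1
      have h4 := lt_of_lt_app (by simp) (per_eq (by simp)) h3
      have h5 := lt_app_of_lt (by simp) (per_eq (by simp))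
        ((neg_le_neg_seq.2 hle).trans_lt h4)
      simpa [-neg_emb] using h5
  · exact absurd h1 (h2 _ _).asymm

theorem Lexi.emb_proper_suffix_lt (hp : Lexi p) {c : List Bool} (hl : c.length < p.length)
    (hc : emb c < emb p) (y : ZSeq) : emb c < app p y := by
  rcases word_trichotomy hl.le with h | ⟨d, rfl⟩ | h
  · exact h _ _
  · rw [emb_append] at hc
    have h0 : (0 : ZSeq) < emb d := app_lt_app.1 hc
    rw [app_append]
    refine app_lt_app.2 ?_
    match d with
    | [] => simp at hl
    | true :: d => exact zero_lt_cons_true _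
    | false :: d => exact absurd h0 (cons_false_lt_zero _).asymm
  · exact absurd hc (h _ _).asymm

theorem Lexi.adm_proper_suffix (hp : Lexi p) {g e : List Bool} (h : p = g ++ e) (hg : g ≠ []) :
    Adm p e := by
  rintro s ⟨t, rfl⟩
  have hgt : g ++ t ≠ [] := by simp [hg]
  have h' : p = (g ++ t) ++ s := by simp [h]
  have hl : s.length < p.length := by
    have := List.length_pos_iff.2 hgt
    rw [h', List.length_append]
    omega
  obtain ⟨h1, h2⟩ := hp _ _ h' hgt
  rw [neg_emb] at h2 ⊢
  rw [om_eq]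
  exact ⟨hp.emb_proper_suffix_lt hl h1 _, hp.emb_proper_suffix_lt (by simpa using hl) h2 _⟩

theorem Adm.blocks (hp : Lexi p) {Y : List Bool} (h : Adm p (p ++ false :: Y)) (j : ℕ) :
    ∃ X : List Bool, X.length = j * (p.length + 1) + Y.length ∧ Adm p (p ++ false :: X) ∧
      emb Y ≤ emb X := by
  induction j with
  | zero => exact ⟨Y, by simp, h, le_rfl⟩
  | succ j ih =>
    obtain ⟨X, h1, h2, h3⟩ := ih
    refine ⟨p ++ false :: X, by simp [h1]; ring, h2.block hp, h3.trans ?_⟩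
    rw [emb_append, emb_cons]
    exact (lt_block (h2.of_suffix ⟨p ++ [false], by simp⟩).lt).le

theorem exists_first_diff {c r : List Bool} (hl : c.length < r.length)
    (h : ∀ x y, app c (cons false x) < app r y) :
    ∃ a r' w, r = a ++ true :: r' ∧ c = a ++ bar w ∧ 0 ≤ emb w := by
  induction c generalizing r with
  | nil =>
    match r with
    | [] => simp at hl
    | true :: r => exact ⟨[], r, [], rfl, rfl, le_rfl⟩
    | false :: r => exact absurd (h (app r 0) 0) (by simp)
  | cons b c ih =>
    match r with
    | [] => simp at hl
    | b' :: r =>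
      by_cases hb : b = b'
      · subst hb
        obtain ⟨a, r', w, rfl, rfl, hw⟩ := ih (r := r) (by simpa using hl) fun x y => by
          simpa using h x y
        exact ⟨b :: a, r', w, rfl, rfl, hw⟩
      · have h0 := h 0 0
        cases b <;> cases b' <;> simp at h0 hb
        exact ⟨[], r, true :: bar c, rfl, by simp, (zero_lt_cons_true _).le⟩

/-- If `|p0M| + 1` is a multiple of `|p| + 1`, then `p1M̄` is lexical. -/
theorem IsMaxAdm.lexi_true_bar (hp : Lexi p) (hA2 : NonDoubling p) (h : IsMaxAdm p M) {j : ℕ}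
    (hj : M.length + 1 = (j + 1) * (p.length + 1)) : Lexi (p ++ true :: bar M) := by
  refine lexi_append_true hp h.adm_right fun g e hge hg => ?_
  have hl : e.length < p.length := by
    have := List.length_pos_iff.2 hg
    simp [hge]; omega
  have he : emb e < emb p := (hp g e hge hg).1
  rcases word_trichotomy hl.le with h2 | ⟨d, hd⟩ | h2
  · exact h2 _ _
  swap
  · exact absurd he (h2 _ _).asymm
  obtain ⟨r, rfl⟩ : ∃ r, d = true :: r := by
    rw [hd, emb_append] at he
    have h0 : (0 : ZSeq) < emb d := app_lt_app.1 he
    match d with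
    | [] => simp at hd; simp [hd] at hl
    | true :: r => exact ⟨r, rfl⟩
    | false :: d => exact absurd h0 (cons_false_lt_zero _).asymm
  -- Here p = e1r with `e` also a suffix of p; cancelling e1 turns the failure into M ≤ r̄0M.
  by_contra hlt
  have hMr : emb M ≤ app (bar r) (cons false (emb M)) := by
    rw [not_lt] at hlt
    conv_lhs at hlt => rw [show app p = app (e ++ true :: r) by rw [← hd]]
    simp only [app_append, app_cons, app_le_app, cons_le_cons] at hlt
    rw [← neg_le_neg_seq, neg_neg, neg_app, neg_cons, neg_neg] at hlt
    exact hlt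
  have hrp : ∀ x y, app (bar r) (cons false x) < app p y :=
    fun x y => hp.bar_suffix_false_lt (g := e ++ [true]) (by simp [hd]) (by simp) x y
  -- The word r̄1ē has length |p| and exceeds M. Were it admissible, j blocks p0 in front would
  -- bring it to length |M|, against maximality.
  by_cases hX : Adm p (bar r ++ true :: bar e)
  · have hMX : emb M < emb (bar r ++ true :: bar e) := by
      rw [emb_append, emb_cons]
      exact hMr.trans_lt (app_lt_app.2 (cons_false_lt _ _))
    obtain ⟨X, h3, h4, h5⟩ := (h.adm.mono hp hX hMX.le).blocks hp j
    refine absurd (hMX.trans_le h5) (h.le X ?_ h4).not_gt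
    have := congrArg List.length hd
    simp at this h3
    rw [h3]
    have : (j + 1) * (p.length + 1) = j * (p.length + 1) + p.length + 1 := by ring
    omega
  -- a suffix `g1ē` of `r̄1ē` is not below `p0p0⋯`
  obtain ⟨z, ⟨z', hz⟩, hzX⟩ : ∃ z, z <:+ bar r ∧ om p ≤ app z (cons true (-emb e)) := by
    by_contra hcon
    push Not at hcon
    refine hX fun s hs => ?_
    rcases suffix_append_cons_cases hs with hs | ⟨z, hz, rfl⟩
    · exact (hp.adm_proper_suffix hge hg).bar s hs
    · constructor
      · rw [emb_append, emb_cons, emb_bar]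
        exact hcon z hz
      · rw [emb_append, emb_cons, emb_bar, neg_app, neg_cons, neg_neg]
        refine hp.suffix_false_lt_om (((by simpa using bar_suffix hz : bar z <:+ r)).trans
          ⟨e ++ [true], by simp [hd]⟩) ?_
        exact (hp.adm_proper_suffix hge hg).lt
  have hzp : p = (e ++ true :: bar z') ++ bar z := by
    rw [hd, ← bar_bar r, ← hz]; simp
  obtain ⟨w, hw⟩ : ∃ w, om p = app (z ++ [true]) w := by
    have h3 := hA2 _ _ hzp (by simp) (cons false (om p))
    rw [← om_eq, bar_bar] at h3
    exact exists_app_of_le_of_le (w := z ++ [true]) (x := -om p) (x' := -emb e)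
      (by simpa using h3.le) (by simpa [-neg_emb] using hzX)
  have hwe : emb e ≤ -w := by
    rw [hw] at hzX
    simp only [app_append, app_cons, app_nil, app_le_app, cons_le_cons] at hzX
    rw [← neg_le_neg_seq, neg_neg]
    exact hzX
  have hw2 : -w < app p (cons false (om p)) := om_tail_true hA2 (e := z) (by simpa using hw) _
  have hMw : -w < emb M := by
    have h3 := (h.adm (bar z ++ false :: M)
      ⟨e ++ true :: bar z', by conv_rhs => rw [hzp]
                               simp⟩).2
    rw [hw, emb_append, emb_cons, neg_app, neg_cons, bar_bar, app_append, app_lt_app] at h3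
    exact neg_lt_seq.1 (cons_lt_cons.1 h3)
  have hMp : emb M < app p (cons false (om p)) := by
    rw [← om_eq]; exact h.adm_right.lt
  have hpe : ∀ x, app p x = app (e ++ [true]) (app r x) := fun x => by
    conv_lhs => rw [show app p = app (e ++ true :: r) by rw [← hd]]
    simp
  -- From e ≤ -w < p0⋯ = e1r0⋯ the sequence -w begins with e, and its next letter is 1. As M lies
  -- between -w and ω, it begins with e1 too.
  obtain ⟨u, hu⟩ : ∃ u, -w = app e u := by
    rw [hpe, app_append] at hw2
    exact exists_app_of_le_of_lt (x := 0) hwe hw2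
  have hu0 : 0 ≤ u := by rw [hu] at hwe; exact app_le_app (x := 0).1 hwe
  obtain ⟨b, u', hb⟩ := om_tail (p := p) (e := z ++ [true] ++ bar e) (y := -u) (by
    rw [app_append, ← neg_app, ← hu, neg_neg, ← hw])
  have hu' : u = cons (!b) (-u') := by rw [← neg_cons, ← hb, neg_neg]
  obtain rfl : b = false := by
    cases b
    · rfl
    · rw [hu'] at hu0
      exact absurd (cons_false_lt_zero _) hu0.not_gt
  obtain ⟨N, hN⟩ : ∃ N, emb M = app (e ++ [true]) N := by
    rw [hu, hu'] at hMw
    rw [hpe] at hMp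
    exact exists_app_of_le_of_lt (by simpa using hMw.le) hMp
  have hr1 : app (e ++ [true]) N ≤ app (bar r) (cons false (emb M)) := by rw [← hN]; exact hMr
  have hr2 := hrp (emb M) 0
  rw [hpe] at hr2
  obtain ⟨N', hN'⟩ := exists_app_of_le_of_lt hr1 hr2
  -- so `r̄` begins with `e1`
  obtain ⟨ρ, hρ⟩ : ∃ ρ, bar r = e ++ true :: ρ := by
    rcases lt_or_ge (bar r).length (e ++ [true]).length with hlr | hlr
    · exfalso
      have h3 : app (bar r ++ [false]) (emb M) = app (e ++ [true]) N' := by simpa using hN'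
      obtain ⟨q, hq, -⟩ := app_eq_app_of_le h3 (by simpa using hlr)
      have h4 := hrp (app q (app r 0)) 0
      rw [hpe, hq] at h4
      simp at h4
    · obtain ⟨ρ, hρ, -⟩ := app_eq_app_of_le hN'.symm hlr
      exact ⟨ρ, by simpa using hρ⟩
  have hρr : ∀ x y, app ρ (cons false x) < app r y := fun x y => by
    have h3 := hrp x y
    rw [hpe, hρ] at h3
    simpa using h3
  have hρl : ρ.length < r.length := by
    have := congrArg List.length hρ
    simp at this
    omega
  obtain ⟨a, r', w', hr', hρ', hw'⟩ := exists_first_diff hρl hρr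
  -- the suffix `a̅w'` of `p` would exceed `p`, which begins with `a̅0`
  have hrr : r = bar e ++ false :: (bar a ++ w') := by
    rw [← bar_bar r, hρ, hρ']; simp
  obtain ⟨q, hq, -⟩ := append_eq_append_of_le (a := a ++ [true]) (b := r')
    (c := bar e ++ false :: bar a) (d := w') (by
      rw [List.append_assoc, List.singleton_append, ← hr', hrr]
      simp) (by simp)
  have hq' : e ++ true :: a = bar a ++ false :: bar q := by
    have := congrArg bar hq
    simpa using this
  have hp1 : p = bar a ++ (false :: (bar q ++ true :: r')) := by
    rw [hd, hr']
    have := congrArg (· ++ true :: r') hq'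
    simpa using this
  have h5 := (hp (e ++ true :: bar e ++ [false]) (bar a ++ w') (by
    conv_lhs => rw [hd, hrr]
    simp) (by simp)).1
  rw [hp1, emb_append_lt, emb_cons] at h5
  exact absurd (h5.trans (cons_false_lt_zero _)) hw'.not_gt

end

/-! ### The bound b ≤ M for lexical p1b̄ with b < ω -/

section
variable {p M : List Bool}

/-- Either `p0W` is admissible for some `W` with `|p0W| = L`, or `L + 1` is a multiple of
`|p| + 1`. -/
def AdmOrBlocks (p : List Bool) (L : ℕ) : Prop :=
  (∃ W : List Bool, W.length + (p.length + 1) = L ∧ Adm p (p ++ false :: W)) ∨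
    ∃ j, L + 1 = (j + 1) * (p.length + 1)

theorem AdmOrBlocks.block (hp : Lexi p) {L : ℕ} (h : AdmOrBlocks p L) :
    AdmOrBlocks p (L + (p.length + 1)) := by
  rcases h with ⟨W, hW, hadm⟩ | ⟨j, hj⟩
  · exact Or.inl ⟨p ++ false :: W, by simp; omega, hadm.block hp⟩
  · refine Or.inr ⟨j + 1, ?_⟩
    have : (j + 1 + 1) * (p.length + 1) = (j + 1) * (p.length + 1) + (p.length + 1) := by ring
    omega

theorem exists_append_of_om_lt {c v : List Bool} (h1 : om p < emb c)
    (h2 : emb c < emb (p ++ v)) : ∃ u, c = p ++ u := by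
  rw [om_eq] at h1
  rw [emb_append] at h2
  obtain ⟨y, hy⟩ := exists_app_of_le_of_lt h1.le h2
  obtain ⟨u, hu, -⟩ := emb_eq_app hy
  exact ⟨u, hu⟩

/-- The words y1p̄ and p0y have equal length, so one common continuation z with y1p̄z < p0yz
suffices. It is the periodic word of 1p̄, or a tail of ω if ω continues `y`. -/
theorem emb_append_true_bar_le (hA2 : NonDoubling p) {y x : List Bool}
    (h : emb (y ++ true :: bar (p ++ x)) < om p) :
    emb (y ++ true :: bar (p ++ x)) ≤ emb (p ++ false :: y) := by
  by_contra hcon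
  rw [not_le] at hcon
  have key : ∃ z, app y (cons true (app (bar p) z)) < app p (cons false (app y z)) := by
    rcases app_trichotomy y (om p) with h1 | ⟨u, hu⟩ | h1
    · refine ⟨per (true :: bar p), ?_⟩
      have h2 := lt_block (h1 (per (true :: bar p)))
      conv_lhs at h2 => rw [per_eq (by simp)]
      simpa using h2
    · obtain ⟨b, w, rfl⟩ := om_tail hu
      cases b
      · rw [hu, emb_append] at h
        exact absurd (app_lt_app.1 h) (not_cons_true_lt _ _)
      · refine ⟨cons true w, ?_⟩
        have h2 := om_tail_true hA2 hu (-(cons true w))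
        rw [neg_lt_seq, neg_app, neg_neg] at h2
        rw [← hu, ← om_eq, hu]
        simpa using h2
    · exact absurd h (by rw [emb_append]; exact (h1 _).asymm)
  obtain ⟨z, hz⟩ := key
  rcases word_trichotomy (c := y ++ true :: bar p) (p := p ++ false :: y) (by simp; omega)
    with h1 | ⟨d, hd⟩ | h1
  · refine absurd (h1 (emb (bar x)) 0) (le_of_lt ?_).not_gt
    simpa [emb] using hcon
  · obtain rfl : d = [] := by
      have := congrArg List.length hd
      simp at this
      exact List.length_eq_zero_iff.1 (by omega)
    refine absurd hz (le_of_eq ?_).not_gt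
    have := congrArg (fun v => app v z) hd
    simpa using this
  · exact absurd (h1 z z) (by simpa using hz.asymm)

/-- Suffixes of `b`, for a lexical word `p1b̄` with `b` between `M` and `p0p0⋯`, can be replaced by
admissible words of the same length which are not smaller. -/
theorem IsMaxAdm.exists_adm_ge (hp : Lexi p) (hA2 : NonDoubling p) (h : IsMaxAdm p M)
    {b : List Bool} (hb : Lexi (p ++ true :: bar b)) (hbo : emb b < om p) (hM : emb M < emb b)
    (hM0 : 0 ≤ emb M) (c : List Bool) (hc : c <:+ b ∨ bar c <:+ b) (hbc : emb b ≤ emb c) :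
    (emb c < om p → ∃ X, X.length = c.length ∧ Adm p X ∧ emb c ≤ emb X) ∧
      (om p < emb c → AdmOrBlocks p c.length) := by
  have hB : ∀ c : List Bool, c <:+ b ∨ bar c <:+ b → emb c < emb (p ++ true :: bar b) := by
    have key : ∀ s, s <:+ b → emb s < emb (p ++ true :: bar b) ∧
        -emb s < emb (p ++ true :: bar b) := by
      rintro s ⟨g, hg⟩
      have := hb (p ++ true :: bar g) (bar s) (by rw [← hg]; simp) (by simp)
      simpa [and_comm] using this
    rintro c (hc | hc)
    · exact (key c hc).1
    · simpa using (key _ hc).2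
  induction hn : c.length using Nat.strong_induction_on generalizing c with
  | _ n ih =>
    subst hn
    constructor
    · intro hco
      by_cases hadm : Adm p c
      · exact ⟨c, rfl, hadm, le_rfl⟩
      -- The shortest `y` gives the longest violating suffix `s`, and s or s̄ begins with p. The
      -- letter before `s` is then 0 or 1 respectively, since otherwise a longer suffix would
      -- violate; the rest of `y` is admissible and is kept.
      have hviol : ∃ n, ∃ y s, c = y ++ s ∧ y.length = n ∧ (om p < emb s ∨ om p < -emb s) := by
        by_contra hcon
        push Not at hcon
        refine hadm fun s ⟨y, hy⟩ => ?_
        have h1 := hcon _ y s hy.symm rfl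
        refine ⟨lt_of_le_of_ne h1.1 (emb_ne_of_eq_app (by simp) (om_eq' p) _),
          lt_of_le_of_ne h1.2 ?_⟩
        rw [neg_emb]
        exact emb_ne_of_eq_app (by simp) (om_eq' p) _
      classical
      obtain ⟨y, s, rfl, hyl, hs⟩ := Nat.find_spec hviol
      have hmin : ∀ s', s' <:+ y ++ s → s.length < s'.length →
          emb s' < om p ∧ -emb s' < om p := by
        rintro s' ⟨y', hy'⟩ hl
        have h0 := congrArg List.length hy'
        simp only [List.length_append] at h0
        have h1 := Nat.find_min hviol (m := y'.length) (by omega)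
        have h2 : ¬ (om p < emb s' ∨ om p < -emb s') := fun hh =>
          h1 ⟨y', s', hy'.symm, rfl, hh⟩
        push Not at h2
        refine ⟨lt_of_le_of_ne h2.1 (emb_ne_of_eq_app (by simp) (om_eq' p) _),
          lt_of_le_of_ne h2.2 ?_⟩
        rw [neg_emb]
        exact emb_ne_of_eq_app (by simp) (om_eq' p) _
      have hc0 : -emb (y ++ s) < om p := by
        have h1 : 0 < emb (y ++ s) := hM0.trans_lt (hM.trans_le hbc)
        have h2 : -emb (y ++ s) < 0 := by simpa [-neg_emb] using neg_lt_neg_seq.2 h1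
        exact h2.trans (h1.trans hco)
      rcases List.eq_nil_or_concat' y with rfl | ⟨y, l, rfl⟩
      · rcases hs with hs | hs
        · exact absurd hs (by simpa using hco.asymm)
        · exact absurd hs (by simpa [-neg_emb] using hc0.asymm)
      simp only [List.append_assoc, List.singleton_append] at *
      obtain ⟨σ, hσ, hσo⟩ : ∃ σ, (σ = s ∨ σ = bar s) ∧ om p < emb σ := by
        rcases hs with hs | hs
        · exact ⟨s, Or.inl rfl, hs⟩
        · exact ⟨bar s, Or.inr rfl, by simpa using hs⟩
      have hσb : σ <:+ b ∨ bar σ <:+ b := by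
        have hsc : s <:+ y ++ l :: s := ⟨y ++ [l], by simp⟩
        have h1 : s <:+ b ∨ bar s <:+ b := by
          rcases hc with hc | hc
          · exact Or.inl (hsc.trans hc)
          · exact Or.inr ((bar_suffix hsc).trans hc)
        rcases hσ with rfl | rfl
        · exact h1
        · simpa [or_comm] using h1
      have hσl : σ.length = s.length := by rcases hσ with rfl | rfl <;> simp
      obtain ⟨x, rfl⟩ := exists_append_of_om_lt hσo (hB σ hσb)
      have hcase : (l = false ∧ s = p ++ x) ∨ (l = true ∧ s = bar (p ++ x)) := by
        have h1 := hmin (l :: s) ⟨y, rfl⟩ (by simp)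
        have hU : ¬ cons true (emb (p ++ x)) < om p := fun h' => by
          rw [om_eq, emb_append] at h'
          exact absurd h' (hp.lt_true_app _ _).asymm
        rcases hσ with hσ | hσ
        · cases l
          · exact Or.inl ⟨rfl, hσ.symm⟩
          · rw [← hσ] at h1; exact absurd h1.1 hU
        · cases l
          · rw [bar_eq_iff.1 hσ.symm] at h1
            exact absurd h1.2 (by simpa using hU)
          · exact Or.inr ⟨rfl, bar_eq_iff.1 hσ.symm⟩
      have hlong : ∀ e, e <:+ p ++ false :: y →
          emb (e ++ l :: s) < om p ∧ -emb (e ++ l :: s) < om p := by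
        intro e he
        rcases suffix_append_cons_cases he with he | ⟨e, he', rfl⟩
        · exact hmin _ (by obtain ⟨g, rfl⟩ := he; exact ⟨g, by simp⟩) (by simp; omega)
        · rw [List.append_assoc, List.cons_append, emb_append, emb_cons]
          refine ⟨hp.suffix_false_lt_om he' hco, ?_⟩
          have h1 := (h.adm (e ++ false :: M)
            (by obtain ⟨g, rfl⟩ := he'; exact ⟨g, by simp⟩)).2
          refine lt_trans ?_ h1
          rw [emb_append e, emb_cons, neg_lt_neg_seq, app_lt_app, cons_lt_cons]
          exact hM.trans_le hbc
      have hyadm : Adm p (p ++ false :: y) := by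
        rcases hcase with ⟨rfl, rfl⟩ | ⟨rfl, rfl⟩
        · refine adm_of_false hp (x := emb x) (fun e he => ?_) fun hns => ?_
          · simpa using hlong e he
          · have h1 := (hlong p hns).1
            rw [emb_append, emb_cons, block_lt_om] at h1
            exact absurd h1 hσo.asymm
        · refine adm_of_true hp (x := emb x) (fun e he => ?_) fun hns => ?_
          · simpa [and_comm] using hlong e he
          · have h1 := (hlong _ hns).2
            rw [emb_append, emb_cons, neg_app, neg_cons, bar_bar, neg_emb, bar_bar,
              Bool.not_true, block_lt_om] at h1
            exact absurd h1 hσo.asymm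
      have hyadm' : Adm p y := hyadm.of_suffix ⟨p ++ [false], by simp⟩
      have hres := (ih s.length (by simp; omega) (p ++ x) hσb (hbo.le.trans hσo.le) hσl).2 hσo
      -- Either `s` and the letter before it are replaced by 1 and the complement of p0W, or |s| + 1
      -- = (j + 1)(|p| + 1) leaves room for exactly j + 1 blocks p0 in front of `y`.
      rcases hres with ⟨W, hW, hWadm⟩ | ⟨j, hj⟩
      · refine ⟨y ++ true :: bar (p ++ false :: W), by simp; omega,
          hyadm'.append_true hA2 hWadm, ?_⟩
        rcases hcase with ⟨rfl, rfl⟩ | ⟨rfl, rfl⟩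
        · rw [emb_append_le]
          exact (emb_false_lt_true _ _).le
        · rw [emb_append_le, emb_cons_le, emb_bar, emb_bar, neg_le_neg_seq]
          exact (hWadm.lt.trans hσo).le
      · obtain ⟨X, h1, h2, h3⟩ := hyadm.blocks hp j
        refine ⟨p ++ false :: X, ?_, h2, ?_⟩
        · have : (j + 1) * (p.length + 1) = j * (p.length + 1) + p.length + 1 := by ring
          simp [h1]
          omega
        · refine le_trans ?_ (show emb (p ++ false :: y) ≤ _ by simpa using h3)
          rcases hcase with ⟨rfl, rfl⟩ | ⟨rfl, rfl⟩
          · have h4 := lt_block hyadm'.lt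
            refine (lt_trans ?_ (show emb y < emb (p ++ false :: y) by simpa using h4)).le
            rw [emb_append]
            exact app_lt_app (w := y) (y := 0).2 (cons_false_lt_zero _)
          · exact emb_append_true_bar_le hA2 hco
    · intro hco
      obtain ⟨u, rfl⟩ := exists_append_of_om_lt hco (hB c hc)
      match u with
      | [] => exact Or.inr ⟨0, by simp⟩
      | l :: v =>
        have hvb : v <:+ b ∨ bar v <:+ b := by
          have hsc : v <:+ p ++ l :: v := ⟨p ++ [l], by simp⟩
          rcases hc with hc | hc
          · exact Or.inl (hsc.trans hc)
          · exact Or.inr ((bar_suffix hsc).trans hc)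
        have hlen : (p ++ l :: v).length = v.length + (p.length + 1) := by simp; omega
        rw [hlen]
        cases l
        · rw [emb_append, emb_cons, om_lt_block] at hco
          exact ((ih v.length (by simp; omega) v hvb (hbo.le.trans hco.le) rfl).2 hco).block hp
        -- Here c = p1v < p1b̄, hence b < v̄ and the induction applies to v̄.
        · have h1 := hB _ hc
          rw [emb_append_lt, emb_cons_lt, emb_bar, lt_neg_seq, ← emb_bar] at h1
          have h2 := ih v.length (by simp; omega) (bar v) (by simpa [or_comm] using hvb) h1.le
            (by simp)
          rcases lt_trichotomy (emb (bar v)) (om p) with h3 | h3 | h3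
          · obtain ⟨X, hX, hXadm, hle⟩ := h2.1 h3
            refine Or.inl ⟨X, by rw [hX], h.adm.mono hp hXadm ?_⟩
            exact (hM.trans (h1.trans_le hle)).le
          · exact absurd h3 (emb_ne_of_eq_app (by simp) (om_eq' p) _)
          · exact (by simpa using h2.2 h3 : AdmOrBlocks p v.length).block hp

/-- If `p1b̄` is lexical and `b` is below `p0p0⋯`, then `b ≤ M`. -/
theorem IsMaxAdm.le_of_lexi (hp : Lexi p) (hA2 : NonDoubling p) (h : IsMaxAdm p M)
    {b : List Bool} (hb : Lexi (p ++ true :: bar b)) (hbo : emb b < om p)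
    (hl : b.length = M.length) : emb b ≤ emb M := by
  by_contra hlt
  rw [not_le] at hlt
  have hM0 : 0 ≤ emb M := by
    rcases h.head hp with rfl | ⟨M', rfl⟩
    · exact le_rfl
    · exact (zero_lt_cons_true _).le
  obtain ⟨X, hX, hXadm, hle⟩ := (h.exists_adm_ge hp hA2 hb hbo hlt hM0 b
    (Or.inl List.suffix_rfl) le_rfl).1 hbo
  exact absurd (hlt.trans_le hle) (h.le_of_adm hp (hX.trans hl) hXadm).not_gt

end
/-! ### Substitution of a word and its complement into a word -/

/-- The word `w`, or its complement. -/
def signed (σ : Bool) (w : List Bool) : List Bool := if σ then w else bar w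

@[simp] theorem signed_true (w : List Bool) : signed true w = w := rfl
@[simp] theorem signed_false (w : List Bool) : signed false w = bar w := rfl
@[simp] theorem length_signed (σ : Bool) (w : List Bool) : (signed σ w).length = w.length := by
  cases σ <;> simp
@[simp] theorem bar_signed (σ : Bool) (w : List Bool) : bar (signed σ w) = signed (!σ) w := by
  cases σ <;> simp

/-- The word `±p x₁ ±p x₂ ⋯ x_k ±p` with the letters `xᵢ` of a word; `p` is taken at the beginning
according to the sign `σ`, after a letter `0`, and is complemented after a letter `1`. -/
def phi (p : List Bool) : Bool → List Bool → List Bool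
  | σ, [] => signed σ p
  | σ, x :: γ => signed σ p ++ x :: phi p (!x) γ

section
variable {p : List Bool}

@[simp] theorem phi_nil (σ : Bool) : phi p σ [] = signed σ p := rfl
@[simp] theorem phi_cons (σ x : Bool) (γ : List Bool) :
    phi p σ (x :: γ) = signed σ p ++ x :: phi p (!x) γ := rfl

@[simp] theorem phi_nil_left (σ : Bool) (γ : List Bool) : phi [] σ γ = γ := by
  induction γ generalizing σ with
  | nil => cases σ <;> rfl
  | cons x γ ih => cases σ <;> simp [ih]

@[simp] theorem bar_phi (σ : Bool) (γ : List Bool) : bar (phi p σ γ) = phi p (!σ) (bar γ) := by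
  induction γ generalizing σ with
  | nil => simp
  | cons x γ ih => simp [ih]

theorem signed_phi (σ : Bool) (γ : List Bool) :
    signed σ (phi p σ γ) = phi p true (signed σ γ) := by
  cases σ <;> simp

theorem length_phi (σ : Bool) (γ : List Bool) :
    (phi p σ γ).length + 1 = (γ.length + 1) * (p.length + 1) := by
  induction γ generalizing σ with
  | nil => simp
  | cons x γ ih =>
    have := ih (!x)
    simp only [phi_cons, List.length_append, length_signed, List.length_cons]
    rw [show (γ.length + 1 + 1) * (p.length + 1) = (γ.length + 1) * (p.length + 1)
      + (p.length + 1) by ring, ← this]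
    omega

theorem phi_append (σ x : Bool) (a s : List Bool) :
    phi p σ (a ++ x :: s) = phi p σ a ++ x :: phi p (!x) s := by
  induction a generalizing σ with
  | nil => simp
  | cons y a ih => simp [ih]

/-- Substitutions compose; this turns substitution of a harmonic into iterated substitution of the
word 1 in `phi_harmWord`. -/
theorem phi_phi (q : List Bool) (σ : Bool) (γ : List Bool) :
    phi (phi p true q) σ γ = phi p σ (phi q σ γ) := by
  induction γ generalizing σ with
  | nil => cases σ <;> simp
  | cons x γ ih =>
    rw [phi_cons, phi_cons, phi_append, ih]
    congr 1
    cases σ <;> simp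

theorem phi_lt_phi_of_lt {γ δ : List Bool} (σ : Bool) (h : emb γ < emb δ) :
    emb (phi p σ γ) < emb (phi p σ δ) := by
  induction γ generalizing δ σ with
  | nil =>
    match δ with
    | [] => exact absurd h (lt_irrefl _)
    | true :: δ => exact emb_lt_append_true _ _
    | false :: δ => exact absurd h (cons_false_lt_zero _).asymm
  | cons x γ ih =>
    match δ with
    | [] =>
      cases x
      · rw [phi_nil, phi_cons, emb_append]
        exact app_lt_app (y := 0).2 (cons_false_lt_zero _)
      · exact absurd h (zero_lt_cons_true _).asymm
    | y :: δ =>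
      cases x <;> cases y <;> simp at h ⊢ <;> exact ih _ h

theorem phi_lt_phi {γ δ : List Bool} {σ : Bool} :
    emb (phi p σ γ) < emb (phi p σ δ) ↔ emb γ < emb δ := by
  refine ⟨fun h => ?_, phi_lt_phi_of_lt σ⟩
  rcases lt_trichotomy (emb γ) (emb δ) with h1 | h1 | h1
  · exact h1
  · rw [emb_inj.1 h1] at h; exact absurd h (lt_irrefl _)
  · exact absurd h (phi_lt_phi_of_lt σ h1).asymm

theorem phi_le_phi {γ δ : List Bool} {σ : Bool} :
    emb (phi p σ γ) ≤ emb (phi p σ δ) ↔ emb γ ≤ emb δ := by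
  rw [← not_lt, ← not_lt, phi_lt_phi]

theorem emb_get_le (w : List Bool) (n : ℕ) : (emb w).get n ≤ 1 := by
  induction w generalizing n with
  | nil => simp [emb]
  | cons b w ih =>
    cases n with
    | zero => cases b <;> simp [emb, cons_zero, sgn]
    | succ n => exact ih n

/-- It suffices to compare with the suffixes after a letter `0` and with the complements of the
suffixes after a letter `1`. -/
theorem lexi_of_signed {γ : List Bool}
    (h : ∀ a x s, γ = a ++ x :: s → emb (signed (!x) s) < emb γ) : Lexi γ := by
  intro g
  induction g using List.reverseRecOn with
  | nil => exact fun s _ h => absurd rfl h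
  | append_singleton g x ih =>
    intro s hs _
    have h0 : 0 < emb γ := by
      rcases List.eq_nil_or_concat' γ with rfl | ⟨a, y, rfl⟩
      · simp at hs
      · have := h a y [] rfl
        cases y <;> exact this
    have h1 := h g x s (by simpa using hs)
    by_cases hg : g = []
    · subst hg
      cases x
      · rw [hs] at h0
        exact absurd h0 (cons_false_lt_zero _).asymm
      · refine ⟨lt_of_le_of_ne ?_ ?_, by simpa using h1⟩
        · rw [hs]
          exact le_cons_true (emb_get_le s)
        · rw [hs, Ne, emb_inj]
          intro h2
          simpa using congrArg List.length h2
    · obtain ⟨h2, h3⟩ := ih (x :: s) (by simpa using hs) hg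
      cases x
      · refine ⟨h1, lt_of_le_of_lt ?_ h3⟩
        rw [emb_cons, neg_cons, neg_emb]
        exact le_cons_true (emb_get_le _)
      · exact ⟨lt_of_le_of_lt (le_cons_true (emb_get_le _)) h2, by simpa using h1⟩

theorem Lexi.signed_lt {γ : List Bool} (h : Lexi γ) {a s : List Bool} {x : Bool}
    (hγ : γ = a ++ x :: s) : emb (signed (!x) s) < emb γ := by
  have := h (a ++ [x]) s (by simp [hγ]) (by simp)
  cases x
  · exact this.1
  · simpa using this.2

/-- The signed suffixes of γ which `lexi_of_signed` asks for are carried by `phi` to signed suffixes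
of the image. -/
theorem Lexi.of_phi {γ : List Bool} (h : Lexi (phi p true γ)) : Lexi γ :=
  lexi_of_signed fun a x s hγ => by
    have := h.signed_lt (a := phi p true a) (x := x) (s := phi p (!x) s)
      (by rw [hγ, phi_append])
    rwa [signed_phi, phi_lt_phi] at this

theorem phi_eq_append {σ x : Bool} {γ a s : List Bool} (h : phi p σ γ = a ++ x :: s) :
    (∃ a' s', γ = a' ++ x :: s' ∧ s = phi p (!x) s') ∨
      ∃ τ u z R, signed τ p = u ++ x :: z ∧ s = z ++ R ∧
        (R = [] ∨ ∃ y γ', R = y :: phi p (!y) γ') := by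
  induction γ generalizing σ a with
  | nil => exact Or.inr ⟨σ, a, s, [], h, by simp, Or.inl rfl⟩
  | cons y γ ih =>
    rw [phi_cons] at h
    rcases List.append_eq_append_iff.1 h with ⟨c, rfl, hc⟩ | ⟨c, hc1, hc2⟩
    · match c with
      | [] =>
        obtain ⟨rfl, rfl⟩ : y = x ∧ phi p (!y) γ = s := by simpa using hc
        exact Or.inl ⟨[], γ, rfl, rfl⟩
      | b :: c =>
        obtain ⟨rfl, h2⟩ : y = b ∧ phi p (!y) γ = c ++ x :: s := by simpa using hc
        rcases ih h2 with ⟨a', s', rfl, rfl⟩ | h3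
        · exact Or.inl ⟨y :: a', s', rfl, rfl⟩
        · exact Or.inr h3
    · match c with
      | [] =>
        obtain ⟨rfl, rfl⟩ : x = y ∧ s = phi p (!y) γ := by simpa using hc2
        exact Or.inl ⟨[], γ, rfl, rfl⟩
      | b :: c =>
        obtain ⟨rfl, rfl⟩ : x = b ∧ s = c ++ y :: phi p (!y) γ := by simpa using hc2
        exact Or.inr ⟨σ, a, c, _, hc1, rfl, Or.inr ⟨y, γ, rfl⟩⟩

/-- This handles cuts inside a block ±p, with R what follows the block. As c < p, only p = c1r and R
= 1p̄x need an argument: p̄x < rY is the complement of r̄⋯ < p⋯. -/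
theorem Lexi.interior_lt (hp : Lexi p) {g c w : List Bool} (hg : p = g ++ w) (hg' : g ≠ [])
    (hc : c = w ∨ c = bar w) {R Y : ZSeq} (hY : Y = 0 ∨ ∃ y, Y = cons true y)
    (hR : R = 0 ∨ (∃ x, R = cons false x) ∨ ∃ x, R = cons true (app (bar p) x)) :
    app c R < app p Y := by
  have hpos : 0 < g.length := List.length_pos_iff.2 hg'
  have hl : c.length < p.length := by
    rcases hc with rfl | rfl <;> simp [hg] <;> omega
  have hcp : emb c < emb p := by
    rcases hc with rfl | rfl
    · exact (hp g _ hg hg').1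
    · simpa using (hp g _ hg hg').2
  rcases hR with rfl | ⟨x, rfl⟩ | ⟨x, rfl⟩
  · exact hp.emb_proper_suffix_lt hl hcp _
  · exact app_false_lt_of_emb_lt hl hcp _ _
  · rcases word_trichotomy hl.le with h | ⟨d, hd⟩ | h
    · exact h _ _
    · obtain ⟨r, rfl⟩ : ∃ r, d = true :: r := by
        rw [hd, emb_append] at hcp
        have h0 : (0 : ZSeq) < emb d := app_lt_app.1 hcp
        match d with
        | [] => simp [hd] at hl
        | true :: r => exact ⟨r, rfl⟩
        | false :: d => exact absurd h0 (cons_false_lt_zero _).asymm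
      have hr : p = (c ++ [true]) ++ r := by simp [hd]
      have hrl : r.length < p.length := by simp [hr]; omega
      have key : app (bar r) (-Y) < app p (-x) := by
        rcases hY with rfl | ⟨y, rfl⟩
        · rw [neg_zero]
          exact hp.emb_proper_suffix_lt (by simpa using hrl)
            (by simpa using (hp _ r hr (by simp)).2) _
        · rw [neg_cons]
          exact hp.bar_suffix_false_lt hr (by simp) _ _
      have key' := neg_lt_neg_seq.2 key
      rw [neg_app, neg_app, neg_neg, neg_neg, bar_bar] at key'
      have hpY : app p Y = app c (cons true (app r Y)) := by
        conv_lhs => rw [show app p = app (c ++ true :: r) by rw [← hd]]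
        simp
      rw [hpY]
      simpa using key'
    · exact absurd hcp (h _ _).asymm

/-- The substitution preserves lexical words. -/
theorem Lexi.phi (hp : Lexi p) {γ : List Bool} (hγ : Lexi γ) : Lexi (phi p true γ) := by
  refine lexi_of_signed fun a x s h => ?_
  rcases phi_eq_append h with ⟨a', s', h1, rfl⟩ | ⟨τ, u, z, R, h1, rfl, hR⟩
  · rw [signed_phi, phi_lt_phi]
    exact hγ.signed_lt h1
  · have hY : ∃ Y, emb (LexSeq.phi p true γ) = app p Y ∧ (Y = 0 ∨ ∃ y, Y = cons true y) := by
      by_cases hγ0 : γ = []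
      · exact ⟨0, by rw [hγ0]; rfl, Or.inl rfl⟩
      · obtain ⟨γ', rfl⟩ := hγ.exists_true hγ0
        exact ⟨emb (true :: LexSeq.phi p false γ'), by rw [phi_cons, signed_true, emb_append]; rfl,
          Or.inr ⟨_, rfl⟩⟩
    obtain ⟨Y, hY1, hY2⟩ := hY
    rw [hY1, show signed (!x) (z ++ R) = signed (!x) z ++ signed (!x) R by cases x <;> simp,
      emb_append]
    refine hp.interior_lt (g := signed τ u ++ [τ == x]) (w := signed τ z) ?_ (by simp) ?_ hY2 ?_
    · rw [← show signed τ (signed τ p) = p by cases τ <;> simp, h1]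
      cases τ <;> cases x <;> simp
    · cases τ <;> cases x <;> simp
    · rcases hR with rfl | ⟨y, γ', rfl⟩
      · left; cases x <;> rfl
      · right
        have hphi : ∀ δ, ∃ v, LexSeq.phi p false δ = bar p ++ v := by
          intro δ
          cases δ with
          | nil => exact ⟨[], by simp⟩
          | cons b δ => exact ⟨_, rfl⟩
        have hsy : ∃ δ, signed (!x) (y :: LexSeq.phi p (!y) γ') =
            (y == !x) :: LexSeq.phi p (!(y == !x)) δ := by
          cases x <;> cases y <;> simp
        obtain ⟨δ, hδ⟩ := hsy
        rw [hδ]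
        cases hyx : (y == !x)
        · exact Or.inl ⟨_, rfl⟩
        · obtain ⟨v, hv⟩ := hphi δ
          exact Or.inr ⟨emb v, by rw [Bool.not_true, hv, emb_cons, emb_append]⟩

/-- Each leading 0 of γ reproduces a block p0 of ω; at the first 1, or at the end of γ, the image
leaves ω upwards. -/
theorem om_lt_phi (γ : List Bool) : om p < emb (phi p true γ) := by
  induction hn : γ.length using Nat.strong_induction_on generalizing γ with
  | _ n ih =>
    match γ with
    | [] =>
      rw [om_eq]
      exact app_lt_app (y := 0).2 (cons_false_lt_zero _)
    | true :: γ => rw [phi_cons, signed_true, emb_append]; exact om_lt_true _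
    | false :: γ =>
      rw [phi_cons, signed_true, emb_append, emb_cons, om_lt_block]
      exact ih γ.length (by simp [← hn]) γ rfl

/-- A lexical word `p1b̄` with `b` above `p0p0⋯` is obtained by substitution. -/
theorem Lexi.exists_phi {b : List Bool} (hb : Lexi (p ++ true :: bar b)) (hbo : om p < emb b) :
    ∃ γ, p ++ true :: bar b = LexSeq.phi p true γ := by
  -- Blocks are read off one by one: a word between ω and p1b̄ begins with p; after a 0 the rest is
  -- again in this range, after a 1 its complement is.
  have key : ∀ n, ∀ c : List Bool, (c <:+ p ++ true :: bar b ∨ bar c <:+ p ++ true :: bar b) →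
      emb c ≤ emb (p ++ true :: bar b) → om p < emb c → c.length = n →
      ∃ γ, c = LexSeq.phi p true γ := by
    intro n
    induction n using Nat.strong_induction_on with
    | _ n ih =>
      rintro c hc hle hlt rfl
      obtain ⟨u, rfl⟩ : ∃ u, c = p ++ u := by
        rcases hle.eq_or_lt with h | h
        · exact ⟨_, emb_inj.1 h⟩
        · exact exists_append_of_om_lt hlt h
      match u with
      | [] => exact ⟨[], by simp⟩
      | l :: v =>
        have hvs : v <:+ p ++ true :: bar b ∨ bar v <:+ p ++ true :: bar b := by
          have hsc : v <:+ p ++ l :: v := ⟨p ++ [l], by simp⟩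
          rcases hc with hc | hc
          · exact Or.inl (hsc.trans hc)
          · exact Or.inr ((bar_suffix hsc).trans hc)
        have hvl : v.length < (p ++ true :: bar b).length := by
          have h1 : (p ++ l :: v).length ≤ (p ++ true :: bar b).length := by
            rcases hc with hc | hc
            · exact hc.length_le
            · simpa using hc.length_le
          have h2 : (p ++ l :: v).length = p.length + (v.length + 1) := by simp
          omega
        have hvβ : emb v < emb (p ++ true :: bar b) ∧ -emb v < emb (p ++ true :: bar b) := by
          rcases hvs with ⟨g, hg⟩ | ⟨g, hg⟩
          · exact hb g v hg.symm (by rintro rfl; simp [← hg] at hvl)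
          · have := hb g (bar v) hg.symm (by rintro rfl; simp [← hg] at hvl)
            simpa [and_comm] using this
        cases l
        · obtain ⟨γ, hγ⟩ := ih v.length (by simp; omega) v hvs hvβ.1.le
            (by rwa [emb_append, emb_cons, om_lt_block] at hlt) rfl
          exact ⟨false :: γ, by rw [hγ]; simp⟩
        · rw [emb_append_le, emb_cons_le, emb_bar] at hle
          obtain ⟨γ, hγ⟩ := ih v.length (by simp; omega) (bar v) (by simpa [or_comm] using hvs)
            (by rw [emb_bar]; exact hvβ.2.le)
            (by rw [emb_bar]; exact hbo.trans_le (by rwa [← neg_le_neg_seq, neg_neg])) (by simp)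
          exact ⟨true :: bar γ, by rw [bar_eq_iff.1 hγ]; simp⟩
  exact key _ _ (Or.inl List.suffix_rfl) le_rfl (by rw [emb_append]; exact om_lt_true _) rfl

end
/-! ### The successor of a lexical word among those of the same length -/

theorem finite_words (N : ℕ) (P : List Bool → Prop) : {w | w.length = N ∧ P w}.Finite :=
  (List.finite_length_eq Bool N).subset fun _ h => h.1

theorem exists_common_prefix {α β : List Bool} (hl : α.length = β.length) (h : emb α < emb β) :
    ∃ p t s, α = p ++ false :: t ∧ β = p ++ true :: s := by
  induction α generalizing β with
  | nil =>
    obtain rfl := List.length_eq_zero_iff.1 hl.symm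
    exact absurd h (lt_irrefl _)
  | cons a α ih =>
    match β with
    | [] => simp at hl
    | b :: β =>
      by_cases hab : a = b
      · subst hab
        obtain ⟨p, t, s, rfl, rfl⟩ := ih (by simpa using hl) (by simpa using h)
        exact ⟨a :: p, t, s, rfl, rfl⟩
      · cases a <;> cases b <;> simp at h hab
        exact ⟨[], α, β, rfl, rfl⟩

theorem emb_le_replicate (w : List Bool) : emb w ≤ emb (List.replicate w.length true) := by
  induction w with
  | nil => exact le_rfl
  | cons b w ih =>
    cases b
    · exact (emb_false_lt_true _ _).le
    · simpa [List.replicate_succ] using ih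

theorem lexi_replicate (N : ℕ) : Lexi (List.replicate N true) := by
  refine lexi_of_signed fun a x s h => ?_
  have hx : x = true := List.eq_of_mem_replicate (a := true) (n := N) (by rw [h]; simp)
  have hs : ∀ y ∈ s, y = true := fun y hy =>
    List.eq_of_mem_replicate (a := true) (n := N) (by rw [h]; simp [hy])
  subst hx
  obtain ⟨N, rfl⟩ : ∃ k, N = k + 1 := ⟨N - 1, by
    have := congrArg List.length h
    simp at this
    omega⟩
  rw [List.replicate_succ]
  match s with
  | [] => exact zero_lt_cons_true _
  | y :: s =>
    obtain rfl := hs y (by simp)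
    exact cons_false_lt _ _

theorem Lexi.exists_isMaxAdm {p t : List Bool} (h : Lexi (p ++ false :: t)) :
    ∃ M, M.length = t.length ∧ IsMaxAdm p M := by
  obtain ⟨M, ⟨hl, hadm⟩, hmax⟩ := Set.exists_max_image _ emb
    (finite_words t.length fun X => Adm p (p ++ false :: X)) ⟨t, rfl, h.adm⟩
  exact ⟨M, hl, hadm, fun X hX hX' => hmax X ⟨hX.trans hl, hX'⟩⟩

/-- For a lexical word `p0t` which is not the greatest of its length, with the first difference to
its successor after `p`: the word `p1t̄` is lexical, and the successor is this word or obtained by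
substitution into the least lexical word of the appropriate length. -/
theorem Lexi.exists_step {α : List Bool} (hα : Lexi α) (hne : α ≠ List.replicate α.length true) :
    ∃ p t, α = p ++ false :: t ∧ Lexi p ∧ (t = [] ∨ ∃ t', t = true :: t') ∧
      Lexi (p ++ true :: bar t) ∧
      (∀ X : List Bool, X.length = t.length → Lexi (p ++ false :: X) → emb X ≤ emb t) ∧
      (¬ p.length + 1 ∣ α.length + 1 → ∀ γ : List Bool, γ.length = α.length → Lexi γ →
        emb α < emb γ → emb (p ++ true :: bar t) ≤ emb γ) ∧
      ∀ l : List Bool, (l.length + 1) * (p.length + 1) = α.length + 1 → Lexi l →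
        (∀ δ : List Bool, δ.length = l.length → Lexi δ → emb l ≤ emb δ) →
        emb α < emb (LexSeq.phi p true l) ∧ ∀ γ : List Bool, γ.length = α.length → Lexi γ →
          emb α < emb γ → emb (LexSeq.phi p true l) ≤ emb γ := by
  have hlt : emb α < emb (List.replicate α.length true) :=
    lt_of_le_of_ne (emb_le_replicate α) fun h => hne (emb_inj.1 h)
  obtain ⟨β, ⟨hβl, hβ, hαβ⟩, hmin⟩ := Set.exists_min_image _ emb
    (finite_words α.length fun w => Lexi w ∧ emb α < emb w)
    ⟨_, by simp, lexi_replicate _, hlt⟩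
  obtain ⟨p, t, s, rfl, rfl⟩ := exists_common_prefix hβl.symm hαβ
  obtain ⟨b, rfl⟩ : ∃ b, s = bar b := ⟨bar s, by simp⟩
  have hbl : b.length = t.length := by simpa using hβl
  have hp : Lexi p := hα.of_prefix hβ
  have hA2 := hα.nonDoubling
  obtain ⟨M, hMl, hM⟩ := hα.exists_isMaxAdm
  -- If t < M, the lexical word p0M would lie strictly between p0t and its successor.
  have hMt : M = t := by
    have h1 := hM.le t hMl.symm hα.adm
    rcases h1.eq_or_lt with h1 | h1
    · exact (emb_inj.1 h1).symm
    · have h2 := hmin (p ++ false :: M) ⟨by simp [hMl], hM.lexi hp hA2, by simpa using h1⟩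
      rw [emb_append_le] at h2
      exact absurd (emb_false_lt_true _ _) h2.not_gt
  subst hMt
  have hlt1 : emb (p ++ false :: M) < emb (p ++ true :: bar M) := by simp
  have hlen : (p ++ false :: M).length + 1 = (M.length + 1) + (p.length + 1) := by simp; omega
  have hwin : om p < emb b → p.length + 1 ∣ (p ++ false :: M).length + 1 := fun h1 => by
    obtain ⟨γ, hγ⟩ := hβ.exists_phi h1
    have h2 := length_phi (p := p) true γ
    rw [← hγ] at h2
    rw [← hβl, h2]
    exact Dvd.intro_left _ rfl
  have hcase : ¬ p.length + 1 ∣ (p ++ false :: M).length + 1 →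
      Lexi (p ++ true :: bar M) ∧ emb (p ++ true :: bar M) ≤ emb (p ++ true :: bar b) := by
    intro hnd
    rcases lt_trichotomy (emb b) (om p) with h1 | h1 | h1
    · have h2 := hM.le_of_lexi hp hA2 hβ h1 hbl
      refine ⟨hp.true_bar_of_le hβ hM.adm_right h2, ?_⟩
      rw [emb_append_le, emb_cons_le, emb_bar, emb_bar, neg_le_neg_seq]
      exact h2
    · exact absurd h1 (emb_ne_of_eq_app (by simp) (om_eq' p) _)
    · exact absurd (hwin h1) hnd
  refine ⟨p, M, rfl, hp, hM.head hp, ?_, fun X hX hX' => hM.le X hX hX'.adm, ?_, ?_⟩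
  · by_cases hd : p.length + 1 ∣ (p ++ false :: M).length + 1
    · rw [hlen, Nat.dvd_add_left dvd_rfl] at hd
      obtain ⟨k, hk⟩ := hd
      obtain ⟨j, rfl⟩ : ∃ j, k = j + 1 := ⟨k - 1, by
        rcases k with _ | k
        · simp at hk
        · rfl⟩
      exact hM.lexi_true_bar hp hA2 (j := j) (by rw [hk, mul_comm])
    · exact (hcase hd).1
  · exact fun hd γ hγl hγ hlt => (hcase hd).2.trans (hmin γ ⟨hγl, hγ, hlt⟩)
  · intro l hll hl hlmin
    have hl0 : l ≠ [] := by
      rintro rfl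
      simp at hll
    obtain ⟨l', rfl⟩ := hl.exists_true hl0
    have hαφ : emb (p ++ false :: M) < emb (LexSeq.phi p true (true :: l')) := by
      rw [phi_cons, signed_true]
      simp
    refine ⟨hαφ, ?_⟩
    have hφl : (LexSeq.phi p true (true :: l')).length = (p ++ false :: M).length := by
      have := length_phi (p := p) true (true :: l')
      omega
    intro γ hγl hγ hlt
    refine le_trans ?_ (hmin γ ⟨hγl, hγ, hlt⟩)
    -- The successor p1b̄ is at most this substituted word, which forces b > ω. So the successor is
    -- itself a substitution, of a word which is at least `l`.
    have h1 := hmin _ ⟨hφl, hp.phi hl, hαφ⟩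
    have h2 : om p < emb b := by
      rw [phi_cons, signed_true, emb_append_le, emb_cons_le, emb_bar, ← neg_le_neg_seq, neg_neg,
        neg_emb, bar_phi] at h1
      exact (om_lt_phi _).trans_le h1
    obtain ⟨δ, hδ⟩ := hβ.exists_phi h2
    rw [hδ, phi_le_phi]
    refine hlmin δ ?_ (Lexi.of_phi (hδ ▸ hβ))
    have h3 := length_phi (p := p) true δ
    rw [← hδ, hβl, ← hll] at h3
    have := Nat.eq_of_mul_eq_mul_right (Nat.succ_pos _) h3
    omega

/-! ### The least lexical words -/

/-- The alternating word of length `n` beginning with `b`. -/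
def alt : Bool → ℕ → List Bool
  | _, 0 => []
  | b, n + 1 => b :: alt (!b) n

@[simp] theorem length_alt (b : Bool) (n : ℕ) : (alt b n).length = n := by
  induction n generalizing b with
  | zero => rfl
  | succ n ih => simp [alt, ih]

@[simp] theorem bar_alt (b : Bool) (n : ℕ) : bar (alt b n) = alt (!b) n := by
  induction n generalizing b with
  | zero => rfl
  | succ n ih => simp [alt, ih]

theorem alt_suffix {b : Bool} {n : ℕ} {s : List Bool} (h : s <:+ alt b n) :
    ∃ c m, s = alt c m := by
  induction n generalizing b with
  | zero => exact ⟨true, 0, by simpa [alt] using h⟩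
  | succ n ih =>
    rcases List.suffix_cons_iff.1 h with rfl | h
    · exact ⟨b, n + 1, rfl⟩
    · exact ih h

theorem emb_alt_lt (b : Bool) (n : ℕ) (x : ZSeq) : emb (alt b n) < cons true (cons true x) := by
  match n with
  | 0 => exact zero_lt_cons_true _
  | 1 =>
    cases b
    · exact cons_false_lt _ _
    · exact cons_lt_cons.2 (zero_lt_cons_true _)
  | n + 2 =>
    cases b
    · exact cons_false_lt _ _
    · exact cons_lt_cons.2 (cons_false_lt _ _)

theorem lexi_true_alt (n : ℕ) : Lexi (true :: alt true (n + 1)) := by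
  rintro g s h hg
  have hs : s <:+ alt true (n + 1) := by
    match g with
    | [] => exact absurd rfl hg
    | b :: g =>
      obtain ⟨-, h⟩ : true = b ∧ alt true (n + 1) = g ++ s := by simpa using h
      exact ⟨g, h.symm⟩
  obtain ⟨c, m, rfl⟩ := alt_suffix hs
  rw [neg_emb, bar_alt]
  exact ⟨emb_alt_lt _ _ _, emb_alt_lt _ _ _⟩

/-- `w` is the least lexical word of its length. -/
def IsLeastWord (w : List Bool) : Prop :=
  Lexi w ∧ ∀ v : List Bool, v.length = w.length → Lexi v → emb w ≤ emb v

theorem isLeastWord_nil : IsLeastWord [] := by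
  refine ⟨lexi_replicate 0, fun v hv _ => ?_⟩
  rw [List.length_eq_zero_iff.1 hv]

theorem om_true_eq : om [true] = cons true (cons false (om [true])) := om_eq _

/-- The two hypotheses force t to begin with 10 and pass to the rest, so descent gives a
contradiction. This excludes the second letter 0 in `Lexi.exists_true_true`. -/
theorem not_neg_lt_of_lt_om (t : List Bool) (h : emb t < om [true])
    (h' : cons true (-emb t) < emb t) : False := by
  induction hn : t.length using Nat.strong_induction_on generalizing t with
  | _ n ih =>
    rw [om_true_eq] at h
    match t with
    | [] => exact absurd h' (zero_lt_cons_true _).asymm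
    | false :: t => exact absurd h' (not_cons_true_lt _ _)
    | [true] => exact absurd (cons_lt_cons.1 h) (cons_false_lt_zero _).asymm
    | true :: true :: t => exact absurd (cons_lt_cons.1 h) (not_cons_true_lt _ _)
    | true :: false :: t =>
      refine ih t.length (by simp [← hn]) t ?_ ?_ rfl
      · exact cons_lt_cons.1 (cons_lt_cons.1 h)
      · simp only [emb_cons, neg_cons, cons_lt_cons, Bool.not_true, Bool.not_false] at h'
        simpa using h'

theorem Lexi.exists_true_true {v : List Bool} (h : Lexi v) (hl : 2 ≤ v.length) :
    ∃ b, v = [true] ++ true :: bar b := by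
  obtain ⟨v, rfl⟩ := h.exists_true (by rintro rfl; simp at hl)
  match v with
  | [] => simp at hl
  | true :: v => exact ⟨bar v, by simp⟩
  | false :: t =>
    exfalso
    refine not_neg_lt_of_lt_om t ?_ ?_
    · have := (h [true, false] t rfl (by simp)).1
      exact lt_om_of_lt_block (p := [true]) this
    · have : -cons false (emb t) < cons true (cons false (emb t)) :=
        (h [true] (false :: t) rfl (by simp)).2
      rw [neg_cons, Bool.not_false, cons_lt_cons, neg_lt_seq, neg_cons] at this
      exact this

theorem emb_le_alt_of_lt_om {b : List Bool} {k : ℕ} (hl : b.length = 2 * k)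
    (h : emb b < om [true]) : emb b ≤ emb (alt true (2 * k)) := by
  induction k generalizing b with
  | zero => rw [List.length_eq_zero_iff.1 hl]; exact le_rfl
  | succ k ih =>
    rw [om_true_eq] at h
    match b with
    | [] => simp at hl
    | [_] => simp at hl; omega
    | false :: y :: b => exact (cons_false_lt _ _).le
    | true :: true :: b => exact absurd (cons_lt_cons.1 h) (not_cons_true_lt _ _)
    | true :: false :: b =>
      have := ih (b := b) (by simp at hl; omega) (cons_lt_cons.1 (cons_lt_cons.1 h))
      rw [show 2 * (k + 1) = 2 * k + 1 + 1 by ring]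
      simpa [alt] using this

/-- A word 11b̄ with b above 1010⋯ would come from substitution of the word 1 and have odd length.
Hence b < 1010⋯, and the greatest such b alternates. -/
theorem isLeastWord_alt (k : ℕ) : IsLeastWord (true :: alt true (2 * k + 1)) := by
  refine ⟨lexi_true_alt _, fun v hv hL => ?_⟩
  obtain ⟨b, rfl⟩ := hL.exists_true_true (by rw [hv]; simp)
  have hbl : b.length = 2 * k := by simpa using hv
  have hb : emb b ≤ emb (alt true (2 * k)) := by
    rcases lt_trichotomy (emb b) (om [true]) with h | h | h
    · exact emb_le_alt_of_lt_om hbl h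
    · exact absurd h (emb_ne_of_eq_app (by simp) (om_eq' _) _)
    · obtain ⟨γ, hγ⟩ := hL.exists_phi h
      have := length_phi (p := [true]) true γ
      rw [← hγ] at this
      simp at this
      omega
  rw [← neg_le_neg_seq, neg_emb, neg_emb, bar_alt] at hb
  simpa [alt] using hb

theorem lexi_singleton : Lexi [true] := lexi_replicate 1

/-- A smaller lexical word 11b̄ would have b above 1010⋯, hence come by substitution from a lexical
word smaller than `w`. -/
theorem IsLeastWord.phi {w : List Bool} (h : IsLeastWord w) : IsLeastWord (phi [true] true w) := by
  refine ⟨lexi_singleton.phi h.1, fun v hv hL => ?_⟩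
  by_contra hlt
  rw [not_le] at hlt
  have hlw := length_phi (p := [true]) true w
  by_cases hw : w = []
  · subst hw
    obtain ⟨v', rfl⟩ := hL.exists_true (by rintro rfl; simp at hv)
    simp at hv
    subst hv
    exact absurd hlt (lt_irrefl _)
  obtain ⟨w, rfl⟩ := h.1.exists_true hw
  obtain ⟨b, rfl⟩ := hL.exists_true_true (by
    rw [hv]
    simp)
  have hb : om [true] < emb b := by
    have h1 := hlt
    rw [phi_cons, signed_true, emb_append_lt, emb_cons_lt, emb_bar, neg_lt_seq, neg_emb,
      bar_phi] at h1
    exact (om_lt_phi _).trans h1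
  obtain ⟨γ, hγ⟩ := hL.exists_phi hb
  rw [hγ, phi_lt_phi] at hlt
  refine absurd hlt (h.2 γ ?_ (Lexi.of_phi (hγ ▸ hL))).not_gt
  have h3 := length_phi (p := [true]) true γ
  rw [← hγ, hv, hlw] at h3
  have := Nat.eq_of_mul_eq_mul_right (Nat.succ_pos _) h3
  omega

/-! ### Sequences as words -/

/-- The word with runs of the given lengths, beginning with a run of the letter `σ`. -/
def encS : Bool → List ℕ → List Bool
  | _, [] => []
  | σ, x :: a => List.replicate x σ ++ encS (!σ) a

/-- The word `1^{a₁} 0^{a₂} 1^{a₃} ⋯` of a sequence. -/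
def enc (a : List ℕ) : List Bool := encS true a

@[simp] theorem encS_nil (σ : Bool) : encS σ [] = [] := rfl
@[simp] theorem encS_cons (σ : Bool) (x : ℕ) (a : List ℕ) :
    encS σ (x :: a) = List.replicate x σ ++ encS (!σ) a := rfl

@[simp] theorem bar_replicate (n : ℕ) (σ : Bool) :
    bar (List.replicate n σ) = List.replicate n (!σ) := by simp [bar]

@[simp] theorem bar_encS (σ : Bool) (a : List ℕ) : bar (encS σ a) = encS (!σ) a := by
  induction a generalizing σ with
  | nil => rfl
  | cons x a ih => simp [ih]

theorem encS_true (a : List ℕ) : encS true a = enc a := rfl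

theorem encS_false (a : List ℕ) : encS false a = bar (enc a) := by simp [enc]

theorem signed_encS (σ : Bool) (a : List ℕ) : signed σ (encS σ a) = enc a := by
  cases σ <;> simp [enc]

@[simp] theorem length_encS (σ : Bool) (a : List ℕ) : (encS σ a).length = a.sum := by
  induction a generalizing σ with
  | nil => rfl
  | cons x a ih => simp [ih]

theorem length_enc (a : List ℕ) : (enc a).length = degree a := length_encS _ _

theorem enc_zero : enc [0] = [] := rfl

theorem encS_append (σ : Bool) (a b : List ℕ) :
    encS σ (a ++ b) = encS σ a ++ encS (if Even a.length then σ else !σ) b := by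
  induction a generalizing σ with
  | nil => simp
  | cons x a ih =>
    rw [List.cons_append, encS_cons, encS_cons, ih, List.append_assoc, List.length_cons]
    congr 3
    by_cases h : Even a.length <;> simp [h, Nat.even_add_one]

/-- All entries are positive. -/
def Pos (a : List ℕ) : Prop := ∀ x ∈ a, 0 < x

theorem Pos.of_cons {x : ℕ} {a : List ℕ} (h : Pos (x :: a)) : 0 < x ∧ Pos a :=
  ⟨h x (by simp), fun y hy => h y (by simp [hy])⟩

theorem Pos.cons {x : ℕ} {a : List ℕ} (hx : 0 < x) (h : Pos a) : Pos (x :: a) := by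
  intro y hy
  rcases List.mem_cons.1 hy with rfl | hy
  · exact hx
  · exact h y hy

theorem pos_append {a b : List ℕ} : Pos (a ++ b) ↔ Pos a ∧ Pos b := by
  simp [Pos, or_imp, forall_and]

theorem pos_nil : Pos [] := by simp [Pos]

theorem Pos.enc_ne_nil {a : List ℕ} (h : Pos a) (ha : a ≠ []) (σ : Bool) : encS σ a ≠ [] := by
  match a with
  | [] => exact absurd rfl ha
  | x :: a =>
    have := (h.of_cons).1
    intro h'
    simp at h'
    omega

theorem zero_le_emb_enc (a : List ℕ) (h : Pos a) : 0 ≤ emb (enc a) := by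
  match a with
  | [] => exact le_rfl
  | x :: a =>
    obtain ⟨y, rfl⟩ := Nat.exists_eq_add_of_lt (h.of_cons).1
    rw [zero_add, enc, encS_cons, List.replicate_succ]
    exact (zero_lt_cons_true _).le

theorem al_zero (a : List ℕ) : al a 0 = a.headD 0 := by
  cases a <;> simp [al]

theorem al_succ (a : List ℕ) (i : ℕ) : al a (i + 1) = -al a.tail i := by
  cases a <;> simp [al, pow_succ]

theorem seqLT_iff_head (a b : List ℕ) :
    SeqLT a b ↔ a.headD 0 < b.headD 0 ∨ a.headD 0 = b.headD 0 ∧ SeqLT b.tail a.tail := by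
  constructor
  · rintro ⟨i, h1, h2⟩
    match i with
    | 0 => rw [al_zero, al_zero] at h2; exact Or.inl (by exact_mod_cast h2)
    | i + 1 =>
      refine Or.inr ⟨?_, i, fun j hj => ?_, ?_⟩
      · have := h1 0 (by omega)
        rw [al_zero, al_zero] at this
        exact_mod_cast this
      · have := h1 (j + 1) (by omega)
        rw [al_succ, al_succ] at this
        omega
      · rw [al_succ, al_succ] at h2
        omega
  · rintro (h | ⟨h, i, h1, h2⟩)
    · exact ⟨0, by simp, by rw [al_zero, al_zero]; exact_mod_cast h⟩
    · refine ⟨i + 1, fun j hj => ?_, by rw [al_succ, al_succ]; omega⟩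
      match j with
      | 0 => rw [al_zero, al_zero, h]
      | j + 1 => rw [al_succ, al_succ, h1 j (by omega)]

theorem emb_enc_head (a : List ℕ) :
    emb (enc a) = app (List.replicate (a.headD 0) true) (-emb (enc a.tail)) := by
  cases a with
  | nil => simp [enc, emb]
  | cons x a => simp [enc]

theorem replicate_app_lt {x y : ℕ} (h : x < y) {u v : ZSeq} (hu : u ≤ 0) :
    app (List.replicate x true) u < app (List.replicate y true) v := by
  obtain ⟨k, rfl⟩ := Nat.exists_eq_add_of_lt h
  rw [add_assoc, List.replicate_add, app_append, app_lt_app, List.replicate_succ, app_cons]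
  exact hu.trans_lt (zero_lt_cons_true _)

theorem Pos.tail {a : List ℕ} (h : Pos a) : Pos a.tail :=
  fun x hx => h x (List.mem_of_mem_tail hx)

/-- The order on sequences is the lexicographic order of the words. -/
theorem seqLT_iff_emb {a b : List ℕ} (ha : Pos a) (hb : Pos b) :
    SeqLT a b ↔ emb (enc a) < emb (enc b) := by
  induction hn : a.length + b.length using Nat.strong_induction_on generalizing a b with
  | _ n ih =>
    have hna : -emb (enc a.tail) ≤ 0 := by
      have := neg_le_neg_seq.2 (zero_le_emb_enc _ ha.tail)
      rwa [neg_zero] at this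
    have hnb : -emb (enc b.tail) ≤ 0 := by
      have := neg_le_neg_seq.2 (zero_le_emb_enc _ hb.tail)
      rwa [neg_zero] at this
    by_cases hab : a = [] ∧ b = []
    · obtain ⟨rfl, rfl⟩ := hab
      simp [SeqLT]
    rw [seqLT_iff_head, emb_enc_head a, emb_enc_head b]
    rcases lt_trichotomy (a.headD 0) (b.headD 0) with h | h | h
    · exact iff_of_true (Or.inl h) (replicate_app_lt h hna)
    · rw [h, app_lt_app, neg_lt_neg_seq, ← ih _ ?_ hb.tail ha.tail rfl]
      · simp
      · subst hn
        simp only [List.length_tail]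
        rcases not_and_or.1 hab with h' | h' <;> have := List.length_pos_iff.2 h' <;> omega
    · refine iff_of_false ?_ (replicate_app_lt h hnb).asymm
      omega

theorem seqLT_zero_left (b : List ℕ) : SeqLT [0] b ↔ SeqLT [] b := by
  rw [seqLT_iff_head, seqLT_iff_head []]; rfl

theorem seqLT_zero_right (a : List ℕ) : SeqLT a [0] ↔ SeqLT a [] := by
  rw [seqLT_iff_head, seqLT_iff_head _ []]; rfl

/-- The degenerate (0) has the same word and the same comparisons as the empty list, so one may work
with positive entries. -/
theorem IsSeq.exists_pos {a : List ℕ} (h : IsSeq a) :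
    ∃ b, Pos b ∧ enc a = enc b ∧ (∀ c, SeqLT a c ↔ SeqLT b c) ∧
      ∀ c, SeqLT c a ↔ SeqLT c b := by
  rcases h with rfl | ⟨-, h⟩
  · exact ⟨[], pos_nil, rfl, seqLT_zero_left, seqLT_zero_right⟩
  · exact ⟨a, h, rfl, fun _ => Iff.rfl, fun _ => Iff.rfl⟩

theorem IsSeq.lt_iff {a b : List ℕ} (ha : IsSeq a) (hb : IsSeq b) :
    SeqLT a b ↔ emb (enc a) < emb (enc b) := by
  obtain ⟨a', ha', ha1, ha2, -⟩ := ha.exists_pos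
  obtain ⟨b', hb', hb1, -, hb3⟩ := hb.exists_pos
  rw [ha2, hb3, seqLT_iff_emb ha' hb', ha1, hb1]

theorem replicate_append_inj {x y : ℕ} {σ : Bool} {u v : List Bool}
    (h : List.replicate x σ ++ u = List.replicate y σ ++ v)
    (hu : ∀ w, u ≠ σ :: w) (hv : ∀ w, v ≠ σ :: w) : x = y ∧ u = v := by
  induction x generalizing y with
  | zero =>
    cases y with
    | zero => exact ⟨rfl, h⟩
    | succ y => exact absurd h (hu _)
  | succ x ih =>
    cases y with
    | zero => exact absurd h.symm (hv _)
    | succ y =>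
      obtain ⟨rfl, h2⟩ := ih (y := y) (by simpa [List.replicate_succ] using h)
      exact ⟨rfl, h2⟩

theorem Pos.encS_not_ne_cons {a : List ℕ} (h : Pos a) (σ : Bool) (w : List Bool) :
    encS (!σ) a ≠ σ :: w := by
  match a with
  | [] => simp
  | x :: a =>
    obtain ⟨y, rfl⟩ := Nat.exists_eq_add_of_lt (h.of_cons).1
    simp [List.replicate_succ]

theorem Pos.encS_inj {a b : List ℕ} (ha : Pos a) (hb : Pos b) {σ : Bool}
    (h : encS σ a = encS σ b) : a = b := by
  induction a generalizing b σ with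
  | nil =>
    by_contra hne
    exact hb.enc_ne_nil (Ne.symm hne) σ h.symm
  | cons x a ih =>
    match b with
    | [] => exact absurd h (ha.enc_ne_nil (by simp) σ)
    | y :: b =>
      obtain ⟨rfl, h2⟩ := replicate_append_inj h (ha.of_cons.2.encS_not_ne_cons σ)
        (hb.of_cons.2.encS_not_ne_cons σ)
      rw [ih ha.of_cons.2 hb.of_cons.2 h2]

theorem IsSeq.enc_inj {a b : List ℕ} (ha : IsSeq a) (hb : IsSeq b) (h : enc a = enc b) :
    a = b := by
  rcases ha with rfl | ⟨ha0, ha⟩ <;> rcases hb with rfl | ⟨hb0, hb⟩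
  · rfl
  · exact absurd h.symm (Pos.enc_ne_nil hb hb0 true)
  · exact absurd h (Pos.enc_ne_nil ha ha0 true)
  · exact Pos.encS_inj ha hb h

theorem encS_eq_append {τ x : Bool} {a : List ℕ} {u s : List Bool} (h : encS τ a = u ++ x :: s) :
    ∃ A v B k l, a = A ++ v :: B ∧ v = k + 1 + l ∧ x = (if Even A.length then τ else !τ) ∧
      u = encS τ A ++ List.replicate k x ∧ s = List.replicate l x ++ encS (!x) B := by
  induction a generalizing τ u with
  | nil => simp at h
  | cons y a ih =>
    rw [encS_cons] at h
    rcases List.append_eq_append_iff.1 h with ⟨c, rfl, hc⟩ | ⟨c, hc, hc2⟩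
    · obtain ⟨A, v, B, k, l, rfl, hv, hx, rfl, hs⟩ := ih hc
      refine ⟨y :: A, v, B, k, l, rfl, hv, ?_, by simp, hs⟩
      rw [hx]
      by_cases h : Even A.length <;> simp [h, Nat.even_add_one]
    · match c with
      | [] =>
        obtain ⟨A, v, B, k, l, rfl, hv, hx, hu, hs⟩ := ih (u := []) (by simpa using hc2.symm)
        refine ⟨y :: A, v, B, k, l, rfl, hv, ?_, ?_, hs⟩
        · rw [hx]
          by_cases h : Even A.length <;> simp [h, Nat.even_add_one]
        · rw [encS_cons, List.append_assoc, ← hu]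
          simpa using hc.symm
      | b :: c =>
        obtain ⟨rfl, rfl⟩ : x = b ∧ s = c ++ encS (!τ) a := by simpa using hc2
        obtain ⟨h1, h2, h3⟩ := List.append_eq_replicate_iff.1 hc.symm
        have hx : x = τ := List.eq_of_mem_replicate (a := τ) (n := (x :: c).length)
          (by rw [← h3]; simp)
        subst hx
        refine ⟨[], y, a, u.length, c.length, rfl, ?_, by simp, ?_, ?_⟩
        · rw [← h1]; simp; omega
        · simpa using h2
        · rw [List.length_cons, List.replicate_succ] at h3
          rw [← (List.cons_inj_right x).1 h3]

theorem IsSeq.isLexical_iff {a : List ℕ} (ha : IsSeq a) : IsLexical a ↔ Lexi (enc a) := by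
  rcases ha with rfl | ⟨ha0, ha⟩
  · refine iff_of_true (fun i hi hi' => ?_) (lexi_replicate 0)
    simp at hi
    omega
  have hdrop : ∀ i, Pos (a.drop i) := fun i x hx => ha x (List.mem_of_mem_drop hx)
  constructor
  · intro h
    have h0 : ∃ w, enc a = true :: w := by
      match a, ha0, ha with
      | x :: a, _, ha =>
        obtain ⟨y, rfl⟩ := Nat.exists_eq_add_of_lt (Pos.of_cons ha).1
        rw [zero_add, enc, encS_cons, List.replicate_succ]
        exact ⟨_, rfl⟩
    refine lexi_of_signed fun u x s hs => ?_
    obtain ⟨A, v, B, k, l, rfl, rfl, -, rfl, rfl⟩ := encS_eq_append hs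
    have h1 : signed (!x) (List.replicate l x ++ encS (!x) B) =
        List.replicate l false ++ enc B := by
      rw [← signed_encS (!x) B]
      cases x <;> simp
    rw [h1]
    -- A cut inside a run (l > 0) leaves a signed suffix beginning with 0; only cuts between cells
    -- use the hypothesis.
    match l with
    | 0 =>
      match B, h with
      | [], _ =>
        obtain ⟨w, hw⟩ := h0
        rw [hw]
        exact zero_lt_cons_true _
      | y :: B, h =>
        have := h (A.length + 1) (by simp) (by omega)
        rw [seqLT_iff_emb (hdrop _) ha] at this
        have hd : (A ++ (k + 1 + 0) :: y :: B).drop (A.length + 1) = y :: B := by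
          rw [← List.drop_drop]
          simp
        rw [hd] at this
        simpa using this
    | l + 1 =>
      obtain ⟨w, hw⟩ := h0
      rw [hw, List.replicate_succ]
      exact cons_false_lt _ _
  · intro h i hi hi'
    rw [seqLT_iff_emb (hdrop _) ha]
    have h1 : enc a = enc (a.take i) ++
        encS (if Even (a.take i).length then true else !true) (a.drop i) := by
      conv_lhs => rw [← List.take_append_drop i a]
      exact encS_append _ _ _
    have h2 : enc (a.take i) ≠ [] := by
      refine Pos.enc_ne_nil (fun x hx => ha x (List.mem_of_mem_take hx)) ?_ _
      intro h3
      have := congrArg List.length h3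
      simp at this
      rcases this with h | h
      · omega
      · exact ha0 h
    obtain ⟨h3, h4⟩ := h _ _ h1 h2
    split_ifs at h3 h4 with h5
    · exact h3
    · rw [Bool.not_true, encS_false] at h4
      simpa using h4

theorem mem_L_iff {n : ℕ} {a : List ℕ} :
    a ∈ L n ↔ IsSeq a ∧ Lexi (enc a) ∧ (enc a).length + 1 = n := by
  unfold L
  rw [Set.mem_ofPred_eq]
  refine and_congr_right fun h => ?_
  rw [h.isLexical_iff, length_enc, add_comm]

/-! ### The elementary operation, the star product and the harmonics as operations on words -/

theorem wedge_append (a b c : List ℕ) : wedge (a ++ b) (a ++ c) = a ++ wedge b c := by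
  induction a with
  | nil => rfl
  | cons x a ih => simp [wedge, ih]

theorem exists_eq_concat {a : List ℕ} (h : ¬ Even a.length) : ∃ b y, a = b ++ [y] := by
  rcases List.eq_nil_or_concat' a with rfl | h'
  · simp at h
  · exact h'

theorem incLast_concat (b : List ℕ) (y : ℕ) : incLast (b ++ [y]) = b ++ [y + 1] := by
  induction b with
  | nil => rfl
  | cons x b ih =>
    match b with
    | [] => rfl
    | z :: b => simpa [incLast] using ih

/-- `A` has odd length, so the cell is even-numbered and its run consists of zeros. Splitting and
conjugation have the same effect on words, and the wedge is the part before the changed letter. -/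
theorem elemOp_spec {A B : List ℕ} {v : ℕ} (hpos : Pos (A ++ v :: B)) (hA : ¬ Even A.length) :
    ∃ c F, elemOp (A ++ v :: B) (A.length + 1) = some c ∧ Pos c ∧ c ≠ [] ∧
      enc c = enc A ++ List.replicate (v - 1) false ++ true :: bar (enc B) ∧
      F = wedge (A ++ v :: B) c ∧ Pos F ∧ F ≠ [] ∧
      enc F = enc A ++ List.replicate (v - 1) false := by
  rw [pos_append] at hpos
  obtain ⟨hpA, hpvB⟩ := hpos
  obtain ⟨hv, hpB⟩ := hpvB.of_cons
  have heven : Even (A.length + 1) := by rw [Nat.even_add_one]; exact hA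
  have hdrop : (A ++ v :: B).drop (A.length + 1) = B := by
    rw [← List.drop_drop]
    simp
  unfold elemOp
  rw [if_neg (by simp)]
  simp only [Nat.add_sub_cancel, List.take_left', hdrop, heven, if_true]
  have hget : (A ++ v :: B).getD A.length 0 = v := by simp
  rw [hget]
  by_cases hv1 : 1 < v
  · obtain ⟨k, rfl⟩ : ∃ k, v = k + 2 := ⟨v - 2, by omega⟩
    refine ⟨A ++ (k + 1) :: 1 :: B, A ++ [k + 1], ?_, ?_, by simp, ?_, ?_, ?_, by simp, ?_⟩
    · rw [if_pos hv1]
      simp [oddExt, heven]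
    · exact pos_append.2 ⟨hpA, (hpB.cons one_pos).cons (by omega)⟩
    · rw [enc, encS_append, if_neg hA]
      simp [encS_false]; rfl
    · rw [wedge_append]
      simp [wedge]
    · exact pos_append.2 ⟨hpA, pos_nil.cons (by omega)⟩
    · rw [enc, encS_append, if_neg hA]
      simp; rfl
  · obtain rfl : v = 1 := by omega
    obtain ⟨b, y, rfl⟩ := exists_eq_concat hA
    have hb : Even b.length := by
      rw [List.length_append, List.length_singleton, Nat.even_add_one, not_not] at hA
      exact hA
    obtain ⟨hpb, hpy⟩ := pos_append.1 hpA
    refine ⟨b ++ (y + 1) :: B, b ++ [y], ?_, ?_, by simp, ?_, ?_, hpA, by simp, by simp⟩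
    · rw [if_neg (by omega), if_pos ⟨rfl, by simp⟩, oddExt, if_neg hA, incLast_concat]
      simp
    · exact pos_append.2 ⟨hpb, hpB.cons (by omega)⟩
    · rw [enc, enc, encS_append, encS_append, if_pos hb]
      simp [List.replicate_succ', encS_false]
    · rw [List.append_assoc, wedge_append]
      simp [wedge]

theorem enc_append_of_odd {A B : List ℕ} (hA : ¬ Even A.length) :
    enc (A ++ B) = enc A ++ bar (enc B) := by
  rw [enc, encS_append, if_neg hA, Bool.not_true, encS_false]
  rfl

theorem enc_append_of_even {A B : List ℕ} (hA : Even A.length) :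
    enc (A ++ B) = enc A ++ enc B := by
  rw [enc, encS_append, if_pos hA]
  rfl

theorem oddExt_spec {F : List ℕ} (h : F ≠ []) :
    ¬ Even (oddExt F).length ∧ enc (oddExt F) = enc F ++ [true] := by
  unfold oddExt
  split_ifs with h1
  · refine ⟨by simpa [Nat.even_add_one] using h1, ?_⟩
    rw [enc_append_of_even h1]
    rfl
  · obtain ⟨b, y, rfl⟩ := exists_eq_concat h1
    have hb : Even b.length := by simpa [Nat.even_add_one] using h1
    rw [incLast_concat, enc_append_of_even hb, enc_append_of_even hb]
    refine ⟨by simpa using h1, ?_⟩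
    simp [enc, List.replicate_succ']

theorem evenExt_spec {F : List ℕ} (h : F ≠ []) :
    Even (evenExt F).length ∧ enc (evenExt F) = enc F ++ [false] := by
  unfold evenExt
  split_ifs with h1
  · rcases List.eq_nil_or_concat' F with rfl | ⟨b, y, rfl⟩
    · exact absurd rfl h
    have hb : ¬ Even b.length := by simpa [Nat.even_add_one] using h1
    rw [incLast_concat, enc_append_of_odd hb, enc_append_of_odd hb]
    refine ⟨by simpa using h1, ?_⟩
    simp [enc, List.replicate_succ']
  · refine ⟨by simpa [Nat.even_add_one] using h1, ?_⟩
    rw [enc_append_of_odd h1]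
    rfl

theorem phi_replicate (p : List Bool) (x : ℕ) (τ : Bool) (γ : List Bool) :
    phi p (!τ) (List.replicate x τ ++ γ) =
      (List.replicate x (signed (!τ) p ++ [τ])).flatten ++ phi p (!τ) γ := by
  induction x with
  | zero => rfl
  | succ x ih => simp [List.replicate_succ, ih]

theorem enc_flatten_evenExt {F : List ℕ} (hF : F ≠ []) (x : ℕ) (R : List ℕ) :
    enc ((List.replicate x (evenExt F)).flatten ++ R) =
      (List.replicate x (enc F ++ [false])).flatten ++ enc R := by
  obtain ⟨h1, h2⟩ := evenExt_spec hF
  induction x with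
  | zero => rfl
  | succ x ih =>
    rw [List.replicate_succ, List.flatten_cons, List.append_assoc, enc_append_of_even h1, ih, h2,
      List.replicate_succ, List.flatten_cons]
    simp

theorem bar_flatten_replicate (k : ℕ) (w : List Bool) :
    bar (List.replicate k w).flatten = (List.replicate k (bar w)).flatten := by
  simp [bar, List.map_flatten]

/-- With p the word of F, `oddExt F` and `evenExt F` have words p1 and p0. The odd length of `oddExt
F` complements everything after it, just as `phi` does after a letter 1, so an entry x gives
p1(p̄1)^{x-1}. -/
theorem enc_star {F β : List ℕ} (hF : F ≠ []) (hβ : Pos β) :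
    enc ((β.flatMap fun x => oddExt F ++ (List.replicate (x - 1) (evenExt F)).flatten) ++ F) =
      phi (enc F) true (enc β) := by
  obtain ⟨h1, h2⟩ := oddExt_spec hF
  induction β with
  | nil => rfl
  | cons x β ih =>
    obtain ⟨hx, hβ'⟩ := hβ.of_cons
    obtain ⟨k, rfl⟩ : ∃ k, x = k + 1 := ⟨x - 1, by omega⟩
    have h3 := phi_replicate (enc F) k true (bar (enc β))
    rw [List.flatMap_cons, List.append_assoc, List.append_assoc, enc_append_of_odd h1,
      enc_flatten_evenExt hF, ih hβ', h2]
    have h4 : enc ((k + 1) :: β) = true :: (List.replicate k true ++ bar (enc β)) := by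
      rw [enc, encS_cons, List.replicate_succ, Bool.not_true, encS_false]
      rfl
    rw [h4, phi_cons, Bool.not_true]
    rw [Bool.not_true] at h3
    rw [h3]
    simp [bar_flatten_replicate]

theorem Pos.incLast {F : List ℕ} (h : Pos F) : Pos (incLast F) := by
  rcases List.eq_nil_or_concat' F with rfl | ⟨b, y, rfl⟩
  · exact h
  · rw [incLast_concat]
    rw [pos_append] at h ⊢
    exact ⟨h.1, pos_nil.cons (by omega)⟩

theorem Pos.oddExt {F : List ℕ} (h : Pos F) : Pos (oddExt F) := by
  unfold LexSeq.oddExt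
  split_ifs
  · exact pos_append.2 ⟨h, pos_nil.cons one_pos⟩
  · exact h.incLast

theorem Pos.evenExt {F : List ℕ} (h : Pos F) : Pos (evenExt F) := by
  unfold LexSeq.evenExt
  split_ifs
  · exact h.incLast
  · exact pos_append.2 ⟨h, pos_nil.cons one_pos⟩

theorem starProd_spec {F β : List ℕ} (hF : IsSeq F) (hβ : Pos β) (hβ0 : β ≠ []) :
    IsSeq (starProd F β) ∧ enc (starProd F β) = phi (enc F) true (enc β) := by
  unfold starProd
  split_ifs with h
  · subst h
    exact ⟨Or.inr ⟨hβ0, hβ⟩, by rw [enc_zero, phi_nil_left]⟩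
  · obtain ⟨hF0, hF⟩ := hF.resolve_left h
    refine ⟨Or.inr ⟨by simp [hF0], ?_⟩, enc_star hF0 hβ⟩
    change Pos _
    rw [pos_append]
    refine ⟨fun y hy => ?_, hF⟩
    obtain ⟨x, -, hy⟩ := List.mem_flatMap.1 hy
    rcases List.mem_append.1 hy with hy | hy
    · exact Pos.oddExt hF _ hy
    · obtain ⟨l, hl, hy⟩ := List.mem_flatten.1 hy
      rw [List.eq_of_mem_replicate hl] at hy
      exact Pos.evenExt hF _ hy

/-- The words of the harmonics of the degenerate sequence. -/
def harmWord : ℕ → List Bool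
  | 0 => []
  | j + 1 => phi (harmWord j) true [true]

theorem harmonic_spec (j : ℕ) :
    IsSeq (harmonic j [0]) ∧ (harmonic j [0] = [0] → j = 0) ∧
      enc (harmonic j [0]) = harmWord j := by
  induction j with
  | zero => exact ⟨Or.inl rfl, fun _ => rfl, rfl⟩
  | succ j ih =>
    obtain ⟨h1, h2, h3⟩ := ih
    by_cases h : harmonic j [0] = [0]
    · obtain rfl := h2 h
      exact ⟨Or.inr ⟨by simp [harmonic], by simp [harmonic]⟩, by simp [harmonic], rfl⟩
    · obtain ⟨hne, hpos⟩ := h1.resolve_left h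
      have h4 : harmonic (j + 1) [0] = oddExt (harmonic j [0]) ++ harmonic j [0] := by
        rw [harmonic, if_neg h]
      rw [h4]
      obtain ⟨h5, h6⟩ := oddExt_spec hne
      have hp : Pos (oddExt (harmonic j [0]) ++ harmonic j [0]) :=
        pos_append.2 ⟨Pos.oddExt hpos, hpos⟩
      refine ⟨Or.inr ⟨by simp [hne], hp⟩, fun h7 => ?_, ?_⟩
      · rw [h7] at hp
        exact absurd (hp 0 (by simp)) (lt_irrefl _)
      · rw [enc_append_of_odd h5, h6, h3, harmWord]
        simp

theorem phi_harmWord (j : ℕ) (γ : List Bool) :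
    phi (harmWord j) true γ = (phi [true] true)^[j] γ := by
  induction j generalizing γ with
  | zero => simp [harmWord]
  | succ j ih => rw [harmWord, phi_phi, ih, Function.iterate_succ_apply]

theorem encS_replicate_one (σ : Bool) (k : ℕ) : encS σ (List.replicate k 1) = alt σ k := by
  induction k generalizing σ with
  | zero => rfl
  | succ k ih => simp [List.replicate_succ, ih, alt]

/-- The word of the starting sequence. -/
theorem startSeq_spec (l s : ℕ) :
    IsSeq (startSeq l s) ∧ IsLeastWord (enc (startSeq l s)) ∧
      (enc (startSeq l s)).length + 1 = 2 ^ l * (2 * s + 1) := by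
  have hiter : ∀ w, IsLeastWord w → IsLeastWord ((phi [true] true)^[l] w) ∧
      ((phi [true] true)^[l] w).length + 1 = 2 ^ l * (w.length + 1) := by
    intro w hw
    induction l with
    | zero => simpa using hw
    | succ l ih =>
      rw [Function.iterate_succ_apply']
      refine ⟨ih.1.phi, ?_⟩
      rw [length_phi, ih.2]
      simp [pow_succ]
      ring
  obtain ⟨h1, -, h3⟩ := harmonic_spec l
  unfold startSeq
  split_ifs with hs
  · subst hs
    refine ⟨h1, ?_⟩
    rw [h3, show harmWord l = phi (harmWord l) true [] from rfl, phi_harmWord]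
    simpa using hiter [] isLeastWord_nil
  · have hpos : Pos (2 :: List.replicate (2 * s - 2) 1) := by
      refine Pos.cons two_pos fun x hx => ?_
      rw [List.eq_of_mem_replicate hx]
      exact one_pos
    obtain ⟨h4, h5⟩ := starProd_spec h1 hpos (by simp)
    refine ⟨h4, ?_⟩
    obtain ⟨k, rfl⟩ : ∃ k, s = k + 1 := ⟨s - 1, by omega⟩
    have h6 : enc (2 :: List.replicate (2 * (k + 1) - 2) 1) = true :: alt true (2 * k + 1) := by
      rw [enc, encS_cons, encS_replicate_one, show 2 * (k + 1) - 2 = 2 * k by omega]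
      rfl
    rw [h5, h6, h3, phi_harmWord]
    have := hiter _ (isLeastWord_alt k)
    simpa [mul_add, add_assoc] using this

theorem start_spec {n : ℕ} (hn : 1 ≤ n) :
    IsSeq (start n) ∧ IsLeastWord (enc (start n)) ∧ (enc (start n)).length + 1 = n := by
  obtain ⟨h1, h2, h3⟩ := startSeq_spec (padicValNat 2 n) (n / 2 ^ padicValNat 2 n / 2)
  refine ⟨h1, h2, h3.trans ?_⟩
  have hdvd : 2 ^ padicValNat 2 n ∣ n := pow_padicValNat_dvd
  have hodd : ¬ 2 ∣ n / 2 ^ padicValNat 2 n := by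
    intro h
    have : 2 ^ (padicValNat 2 n + 1) ∣ n := by
      rw [pow_succ]
      exact Nat.mul_dvd_of_dvd_div hdvd h
    exact pow_succ_padicValNat_not_dvd (by omega) this
  rw [show 2 * (n / 2 ^ padicValNat 2 n / 2) + 1 = n / 2 ^ padicValNat 2 n by omega]
  exact Nat.mul_div_cancel' hdvd

/-! ### The algorithm -/

theorem isLeastIn_start {n : ℕ} (hn : 1 ≤ n) : IsLeastIn (L n) (start n) := by
  obtain ⟨h1, h2, h3⟩ := start_spec hn
  refine ⟨mem_L_iff.2 ⟨h1, h2.1, h3⟩, fun a ha hne => ?_⟩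
  obtain ⟨ha1, ha2, ha3⟩ := mem_L_iff.1 ha
  rw [h1.lt_iff ha1]
  refine lt_of_le_of_ne (h2.2 _ (by omega) ha2) fun h => hne ?_
  exact ha1.enc_inj h1 (emb_inj.1 h.symm)

theorem isSeq_singleton (k : ℕ) : IsSeq [k] := by
  rcases Nat.eq_zero_or_pos k with rfl | hk
  · exact Or.inl rfl
  · exact Or.inr ⟨by simp, by simpa using hk⟩

theorem enc_singleton (k : ℕ) : enc [k] = List.replicate k true := by simp [enc]

theorem isGreatestIn_singleton {n : ℕ} (hn : 1 ≤ n) : IsGreatestIn (L n) [n - 1] := by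
  refine ⟨mem_L_iff.2 ⟨isSeq_singleton _, ?_, ?_⟩, fun a ha hne => ?_⟩
  · rw [enc_singleton]; exact lexi_replicate _
  · rw [enc_singleton, List.length_replicate]; omega
  · obtain ⟨ha1, ha2, ha3⟩ := mem_L_iff.1 ha
    rw [ha1.lt_iff (isSeq_singleton _), enc_singleton, show n - 1 = (enc a).length by omega]
    refine lt_of_le_of_ne (emb_le_replicate _) fun h => hne ?_
    refine ha1.enc_inj (isSeq_singleton _) ?_
    rw [emb_inj.1 h, enc_singleton]
    congr 1
    omega

theorem findSome?_reverse_range {β : Type*} (f : ℕ → Option β) {N i : ℕ} {b : β} (hi : i < N)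
    (hfi : f i = some b) (h : ∀ j, i < j → j < N → f j = none) :
    (List.range N).reverse.findSome? f = some b := by
  induction N with
  | zero => omega
  | succ N ih =>
    rw [List.range_succ, List.reverse_append, List.reverse_singleton, List.singleton_append,
      List.findSome?_cons]
    by_cases hiN : i = N
    · subst hiN; rw [hfi]
    · rw [h N (by omega) (by omega)]
      exact ih (by omega) fun j h1 h2 => h j h1 (by omega)

/-- An operation on a later even cell keeps the prefix p0; a successor in `L n` obtained so would be
p0X with X > t, against `hmax`. -/
theorem raise_eq {n : ℕ} {a A B c : List ℕ} {v : ℕ} (ha : a ∈ L n) (hpos : Pos a)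
    (haAB : a = A ++ v :: B) (hA : ¬ Even A.length) (hc : elemOp a (A.length + 1) = some c)
    (hcL : c ∈ L n) (hac : SeqLT a c) {p t : List Bool} (henc : enc a = p ++ false :: t)
    (hp : p ++ [false] = enc A ++ List.replicate v false)
    (hmax : ∀ X : List Bool, X.length = t.length → Lexi (p ++ false :: X) → emb X ≤ emb t) :
    raise n a = some c := by
  unfold raise
  have heven : Even (A.length + 1) := by rw [Nat.even_add_one]; exact hA
  refine findSome?_reverse_range _ (i := A.length + 1) (by rw [haAB]; simp) ?_ ?_
  · rw [raiseAt, if_pos heven, hc]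
    simp [hcL, hac]
  · intro i hi hil
    unfold raiseAt
    split_ifs with hie
    swap
    · rfl
    obtain ⟨A', v', B', hA'B', hA'⟩ : ∃ A' v' B', a = A' ++ v' :: B' ∧ A'.length + 1 = i := by
      have h1 : i - 1 < a.length := by omega
      refine ⟨a.take (i - 1), a[i - 1], a.drop (i - 1 + 1), ?_, ?_⟩
      · simp
      · rw [List.length_take]; omega
    subst hA'
    obtain ⟨C, rfl⟩ : ∃ C, A' = A ++ v :: C := by
      obtain ⟨e, he, he'⟩ := append_eq_append_of_le (haAB.symm.trans hA'B') (by omega)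
      match e with
      | [] => simp at he; subst he; omega
      | y :: C =>
        obtain ⟨rfl, -⟩ : v = y ∧ B = C ++ v' :: B' := by simpa using he'
        exact ⟨C, he⟩
    have hodd : ¬ Even (A ++ v :: C).length := by
      rwa [Nat.even_add_one] at hie
    obtain ⟨c', F, h1, h2, h3, h4, -⟩ := elemOp_spec (hA'B' ▸ hpos) hodd
    rw [hA'B', h1, Option.filter_some, if_neg]
    rw [decide_eq_true_eq, ← hA'B']
    rintro ⟨hc'L, hac'⟩
    obtain ⟨ha1, -, ha3⟩ := mem_L_iff.1 ha
    obtain ⟨hc1, hc2, hc3⟩ := mem_L_iff.1 hc'L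
    rw [ha1.lt_iff hc1, henc] at hac'
    obtain ⟨X, hX⟩ : ∃ X, enc c' = p ++ false :: X := by
      have h5 : enc (A ++ v :: C) = (p ++ [false]) ++ encS true C := by
        rw [hp, enc, encS_append, if_neg hA]
        simp; rfl
      rw [h4, h5]
      simp
    rw [hX] at hac' hc2 hc3
    have hlt : emb t < emb X := by simpa using hac'
    rw [henc] at ha3
    simp only [List.length_append, List.length_cons] at ha3 hc3
    exact absurd hlt (hmax X (by omega) hc2).not_gt

theorem adjIn_of_enc {n : ℕ} {a b : List ℕ} (ha : a ∈ L n) (hb : b ∈ L n)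
    (hab : emb (enc a) < emb (enc b))
    (h : ∀ γ : List Bool, γ.length = (enc a).length → Lexi γ → emb (enc a) < emb γ →
      emb (enc b) ≤ emb γ) : AdjIn (L n) a b := by
  obtain ⟨ha1, ha2, ha3⟩ := mem_L_iff.1 ha
  obtain ⟨hb1, hb2, hb3⟩ := mem_L_iff.1 hb
  refine ⟨ha, hb, (ha1.lt_iff hb1).2 hab, ?_⟩
  rintro ⟨c, hc, hac, hcb⟩
  obtain ⟨hc1, hc2, hc3⟩ := mem_L_iff.1 hc
  rw [ha1.lt_iff hc1] at hac
  rw [hc1.lt_iff hb1] at hcb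
  exact absurd hcb (h _ (by omega) hc2 hac).not_gt

/-- One round of the algorithm. -/
theorem exists_raise {n : ℕ} {a : List ℕ} (ha : a ∈ L n) (hne : a ≠ [n - 1]) :
    ∃ a' f : List ℕ, ∃ m : ℕ,
      raise n a = some a' ∧ a' ∈ L n ∧ f = wedge a a' ∧ f ∈ L m ∧
      (¬ m ∣ n → step n a = some a' ∧ AdjIn (L n) a a') ∧
      (m ∣ n → ∃ lam : List ℕ, lam = start (n / m) ∧ IsLeastIn (L (n / m)) lam ∧
        step n a = some (starProd f lam) ∧ AdjIn (L n) a (starProd f lam)) := by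
  obtain ⟨ha1, ha2, ha3⟩ := mem_L_iff.1 ha
  have hne' : enc a ≠ List.replicate (enc a).length true := fun h => hne <| by
    refine ha1.enc_inj (isSeq_singleton _) ?_
    rw [h, enc_singleton]
    congr 1
    omega
  obtain ⟨p, t, hpt, hp, ht, hL, hmax, hnd, hd⟩ := ha2.exists_step hne'
  obtain ⟨-, hpos⟩ : a ≠ [] ∧ Pos a := ha1.resolve_left fun h => by
    rw [h, enc_zero] at hpt
    simp at hpt
  obtain ⟨A, v, B, k, l, haAB, hv, hx, hpA, htB⟩ := encS_eq_append hpt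
  have hA : ¬ Even A.length := fun h => by simp [h] at hx
  -- As t is empty or begins with 1, the 0 after p is the last of its run, so the operation on this
  -- cell gives p1t̄.
  obtain rfl : l = 0 := by
    rcases l with _ | l
    · rfl
    · rw [List.replicate_succ] at htB
      rcases ht with rfl | ⟨t', rfl⟩ <;> simp at htB
  have htB' : t = enc B := by simpa [encS_true] using htB
  have hv1 : v - 1 = k := by omega
  obtain ⟨c, F, h1, h2, h3, h4, h5, h6, h7, h8⟩ := elemOp_spec (haAB ▸ hpos) hA
  rw [← haAB] at h1 h5
  rw [hv1] at h4 h8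
  have hF : enc F = p := by rw [h8, hpA]; rfl
  have hc : enc c = p ++ true :: bar t := by rw [h4, ← h8, hF, htB']
  have hcs : IsSeq c := Or.inr ⟨h3, h2⟩
  have hFs : IsSeq F := Or.inr ⟨h7, h6⟩
  have hlen : (enc a).length = p.length + (t.length + 1) := by rw [hpt]; simp
  have hcL : c ∈ L n := mem_L_iff.2 ⟨hcs, by rwa [hc], by rw [hc]; simp; omega⟩
  have hacE : emb (enc a) < emb (enc c) := by rw [hc, hpt]; simp
  have hac : SeqLT a c := (ha1.lt_iff hcs).2 hacE
  have hFd : degree F + 1 = p.length + 1 := by rw [← length_enc, hF]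
  have hraise : raise n a = some c := raise_eq ha hpos haAB hA h1 hcL hac hpt (by
    rw [hpA, hv, List.append_assoc, ← List.replicate_succ']
    rfl) hmax
  refine ⟨c, F, p.length + 1, hraise, hcL, h5, mem_L_iff.2 ⟨hFs, by rwa [hF], by rw [hF]⟩, ?_, ?_⟩
  · intro hdvd
    refine ⟨?_, adjIn_of_enc ha hcL hacE ?_⟩
    · simp only [step, hraise, Option.map_some, ← h5, hFd, if_neg hdvd]
    · rw [hc]
      exact hnd (by rwa [ha3])
  · intro hdvd
    have hdiv : n / (p.length + 1) * (p.length + 1) = n := Nat.div_mul_cancel hdvd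
    -- Since n = |p| + |t| + 2 > |p| + 1, the starting sequence for the quotient is not (0), as
    -- `starProd_spec` requires.
    have hd2 : 2 ≤ n / (p.length + 1) := by
      by_contra hlt
      have : n / (p.length + 1) ≤ 1 := by omega
      have := Nat.mul_le_mul_right (p.length + 1) this
      omega
    obtain ⟨hs1, hs2, hs3⟩ := start_spec (n := n / (p.length + 1)) (by omega)
    obtain ⟨hs4, hs5⟩ := hs1.resolve_left fun h => by
      rw [h, enc_zero] at hs3
      simp at hs3
      omega
    obtain ⟨h9, h10⟩ := starProd_spec hFs hs5 hs4
    obtain ⟨h11, h12⟩ := hd (enc (start (n / (p.length + 1)))) (by rw [hs3, hdiv, ha3]) hs2.1 hs2.2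
    rw [hF] at h10
    rw [← h10] at h11 h12
    refine ⟨_, rfl, isLeastIn_start (by omega), ?_, adjIn_of_enc ha ?_ h11 h12⟩
    · simp only [step, hraise, Option.map_some, ← h5, hFd, if_pos hdvd]
    · refine mem_L_iff.2 ⟨h9, ?_, ?_⟩
      · rw [h10]
        exact hp.phi hs2.1
      · rw [h10, length_phi, hs3, hdiv]

theorem finite_L (n : ℕ) : (L n).Finite := by
  refine Set.Finite.of_finite_image (f := enc) ((List.finite_length_le Bool n).subset ?_) ?_
  · rintro _ ⟨a, ha, rfl⟩
    have := (mem_L_iff.1 ha).2.2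
    change (enc a).length ≤ n
    omega
  · exact fun a ha b hb h => (mem_L_iff.1 ha).1.enc_inj (mem_L_iff.1 hb).1 h

/-- Induction on the number of elements of `L n` above `a`; adjacency ensures that a step skips none
of them. -/
theorem exists_run {n : ℕ} (hn : 1 ≤ n) {a : List ℕ} (ha : a ∈ L n) :
    ∃ out, Run n a out ∧ out.Pairwise SeqLT ∧
      ∀ c, c ∈ out ↔ c ∈ L n ∧ (c = a ∨ SeqLT a c) := by
  have hlt : ∀ {a b}, a ∈ L n → b ∈ L n → (SeqLT a b ↔ emb (enc a) < emb (enc b)) :=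
    fun ha hb => (mem_L_iff.1 ha).1.lt_iff (mem_L_iff.1 hb).1
  induction hN : {c ∈ L n | SeqLT a c}.ncard using Nat.strong_induction_on generalizing a with
  | _ N ih =>
    subst hN
    by_cases hne : a = [n - 1]
    · subst hne
      refine ⟨_, Run.halt, by simp, fun c => ?_⟩
      rw [List.mem_singleton]
      constructor
      · rintro rfl
        exact ⟨ha, Or.inl rfl⟩
      · rintro ⟨hc, h | h⟩
        · exact h
        · by_contra hcne
          have h1 := (isGreatestIn_singleton hn).2 c hc hcne
          rw [hlt hc ha] at h1
          rw [hlt ha hc] at h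
          exact h1.asymm h
    obtain ⟨b, hstep, -, hb, hab, hadj⟩ : ∃ b, step n a = some b ∧ AdjIn (L n) a b := by
      obtain ⟨a', f, m, -, -, -, -, h1, h2⟩ := exists_raise ha hne
      by_cases hm : m ∣ n
      · obtain ⟨lam, -, -, h⟩ := h2 hm
        exact ⟨_, h⟩
      · exact ⟨_, h1 hm⟩
    have hsub : {c ∈ L n | SeqLT b c} ⊂ {c ∈ L n | SeqLT a c} := by
      refine ⟨fun c hc => ⟨hc.1, ?_⟩, fun h => ?_⟩
      · rw [hlt ha hc.1]
        exact ((hlt ha hb).1 hab).trans ((hlt hb hc.1).1 hc.2)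
      · have := (h ⟨hb, hab⟩).2
        rw [hlt hb hb] at this
        exact lt_irrefl _ this
    have hfin : {c ∈ L n | SeqLT a c}.Finite := (finite_L n).subset fun c hc => hc.1
    obtain ⟨out, h1, h2, h3⟩ := ih _ (Set.ncard_lt_ncard hsub hfin) hb rfl
    refine ⟨a :: out, Run.next hne hstep h1, List.pairwise_cons.2 ⟨fun c hc => ?_, h2⟩,
      fun c => ?_⟩
    · obtain ⟨hcL, rfl | hc⟩ := (h3 c).1 hc
      · exact hab
      · rw [hlt ha hcL]
        exact ((hlt ha hb).1 hab).trans ((hlt hb hcL).1 hc)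
    · rw [List.mem_cons, h3]
      constructor
      · rintro (rfl | ⟨hcL, rfl | hc⟩)
        · exact ⟨ha, Or.inl rfl⟩
        · exact ⟨hcL, Or.inr hab⟩
        · refine ⟨hcL, Or.inr ?_⟩
          rw [hlt ha hcL]
          exact ((hlt ha hb).1 hab).trans ((hlt hb hcL).1 hc)
      · rintro ⟨hcL, rfl | hc⟩
        · exact Or.inl rfl
        · refine Or.inr ⟨hcL, ?_⟩
          by_cases hcb : c = b
          · exact Or.inl hcb
          · right
            rw [hlt hb hcL]
            refine lt_of_le_of_ne ?_ fun h => hcb ?_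
            · by_contra hlt'
              exact hadj ⟨c, hcL, hc, (hlt hcL hb).2 (not_le.1 hlt')⟩
            · exact (mem_L_iff.1 hcL).1.enc_inj (mem_L_iff.1 hb).1 (emb_inj.1 h.symm)

end LexSeq

theorem mainTheorem4 (n : ℕ) (hn : 1 ≤ n) :
    IsLeastIn (L n) (start n) ∧
    IsGreatestIn (L n) [n - 1] ∧
    (∀ a ∈ L n, a ≠ [n - 1] →
      ∃ a' f : List ℕ, ∃ m : ℕ,
        raise n a = some a' ∧ a' ∈ L n ∧ f = wedge a a' ∧ f ∈ L m ∧
        (¬ m ∣ n → step n a = some a' ∧ AdjIn (L n) a a') ∧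
        (m ∣ n → ∃ lam : List ℕ, lam = start (n / m) ∧ IsLeastIn (L (n / m)) lam ∧
          step n a = some (starProd f lam) ∧ AdjIn (L n) a (starProd f lam))) ∧
    ∃ out : List (List ℕ),
      Run n (start n) out ∧ out.Pairwise SeqLT ∧ ∀ a : List ℕ, a ∈ out ↔ a ∈ L n := by
  have hleast := isLeastIn_start hn
  refine ⟨hleast, isGreatestIn_singleton hn, fun a ha hne => exists_raise ha hne, ?_⟩
  obtain ⟨out, h1, h2, h3⟩ := exists_run hn hleast.1
  refine ⟨out, h1, h2, fun a => (h3 a).trans ⟨fun h => h.1, fun h => ⟨h, ?_⟩⟩⟩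
  by_cases hne : a = start n
  · exact Or.inl hne
  · exact Or.inr (hleast.2 a h hne)
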